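/- Let $A=(a_{ij})_{i,j=1}^n$ be the Cartan matrix of a complex semisimple Lie algebra $\mathfrak g$, let $d_1,\dots,d_n\in\{1,2,3\}$ be such that $(d_ia_{ij})$ is symmetric and positive definite, and let $q\in\mathbb C\setminus\{0\}$ not be a root of unity; put $q_i=q^{d_i}$. Let $U=U_q(\mathfrak g)$ be the unital associative $\mathbb C$-algebra generated by $E_i,F_i,K_i,K_i^{-1}$ ($1\le i\le n$) subject to $$K_iK_i^{-1}=1=K_i^{-1}K_i,\quad K_iK_j=K_jK_i,\quad K_iE_jK_i^{-1}=q_i^{a_{ij}}E_j,\quad K_iF_jK_i^{-1}=q_i^{-a_{ij}}F_j,$$ $$E_iF_j-F_jE_i=\delta_{ij}\frac{K_i-K_i^{-1}}{q_i-q_i^{-1}},$$ and, for $i\neq j$, the $q$-Serre relations $$\sum_{r=0}^{1-a_{ij}}(-1)^r\binom{1-a_{ij}}{r}_{q_i}E_i^{1-a_{ij}-r}E_jE_i^r=0,\qquad \sum_{r=0}^{1-a_{ij}}(-1)^r\binom{1-a_{ij}}{r}_{q_i}F_i^{1-a_{ij}-r}F_jF_i^r=0,$$ where $\binom{n}{k}_q=\frac{[n]_q!}{[k]_q!\,[n-k]_q!}$,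 $[k]_q!=\prod_{j=1}^k[j]_q$ and $[j]_q=\frac{q^j-q^{-j}}{q-q^{-1}}$. Let $U^+$, $U^-$, $U^0$ be the subalgebras generated by the $E_i$, by the $F_i$, and by the $K_i^{\pm1}$, respectively. Let $Q=\bigoplus_i\mathbb Z\alpha_i$ be the root lattice with the bilinear form $(\alpha_i,\alpha_j)=d_ia_{ij}$, and $Q^+=\bigoplus_i\mathbb N_0\alpha_i$. For $\gamma\in Q$ put $U_\gamma=\{X\in U : K_iXK_i^{-1}=q^{(\alpha_i,\gamma)}X \text{ for all } i\}$ and $U^\pm_\gamma=U^\pm\cap U_\gamma$; in particular $U_0$ is the centralizer of $U^0$ in $U$. For $\sigma\in Q^+$ put $U_{0,\sigma}=U^+_\sigma U^0U^-_{-\sigma}$. For $S\subseteq\{1,\dots,n\}$ let $Q^+_S=\bigoplus_{i\in S}\mathbb N_0\alpha_i$ and $$U_0^S=\sum_{\gamma\in Q^+_S}U_{0,\gamma},\qquad I^S=\sum_{\gamma\in Q^+\setminus Q^+_S}U_{0,\gamma}.$$ Assume that $a_{ij}=0$ for all distinct $i,j\in S$. Then: 1. $U_0=U_0^S\oplus I^S$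 as vector spaces. 2. $U_0^S$ is a commutative subalgebra of $U_0$, and it is generated as an algebra by the elements $E_iF_i$ ($i\in S$) and $K_j^{\pm1}$ ($1\le j\le n$). 3. $I^S$ is a two-sided ideal of $U_0$. 4. Every one-dimensional representation of $U_0^S$, i.e. every unital algebra homomorphism $U_0^S\to\mathbb C$, extends to a one-dimensional representation $U_0\to\mathbb C$ of $U_0$. -/

import Mathlib

/-- `A` is a Cartan matrix of finite type (the Cartan matrix of a complex semisimple Lie algebra)
and `d` is a choice of symmetrizing integers: `DA` is symmetric and positive definite, where
`D = diag (d_i)` and `d_i ∈ {1, 2, 3}`. -/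
structure IsFiniteCartanDatum {ι : Type*} [Fintype ι] [DecidableEq ι]
    (A : Matrix ι ι ℤ) (d : ι → ℕ) : Prop where
  diag : ∀ i, A i i = 2
  offDiag : ∀ i j, i ≠ j → A i j ≤ 0
  d_mem : ∀ i, d i = 1 ∨ d i = 2 ∨ d i = 3
  symm : ∀ i j, (d i : ℤ) * A i j = (d j : ℤ) * A j i
  posDef : (Matrix.of fun i j => ((d i : ℝ) * (A i j : ℝ))).PosDef

noncomputable section

namespace QuantumEnveloping

/-- The `q`-number `[n]_q = (q ^ n - q ^ (-n)) / (q - q ^ (-1))`. -/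
def qNumber (q : ℂ) (n : ℕ) : ℂ := (q ^ n - (q ^ n)⁻¹) / (q - q⁻¹)

/-- The `q`-factorial `[n]_q! = [1]_q [2]_q ⋯ [n]_q`. -/
def qFactorial (q : ℂ) (n : ℕ) : ℂ := ∏ j ∈ Finset.Icc 1 n, qNumber q j

/-- The `q`-binomial coefficient (for `k ≤ n`). -/
def qBinomial (q : ℂ) (n k : ℕ) : ℂ :=
  qFactorial q n / (qFactorial q k * qFactorial q (n - k))

/-- Generators of the quantized enveloping algebra. -/
inductive Gen (ι : Type*) where
  | E : ι → Gen ι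
  | F : ι → Gen ι
  | K : ι → Gen ι
  | Kinv : ι → Gen ι

section Relations

variable {ι : Type*} [DecidableEq ι]

/-- A generator in the free algebra. -/
abbrev gen (g : Gen ι) : FreeAlgebra ℂ (Gen ι) := FreeAlgebra.ι ℂ g

/-- The `q_i`-Serre expression
`∑_{r = 0}^{1 - a_{ij}} (-1)^r [1 - a_{ij} choose r]_{q_i} x ^ (1 - a_{ij} - r) y x ^ r`
with `c = q_i` and `m = 1 - a_{ij}`. -/
def serre {R : Type*} [Ring R] [Algebra ℂ R] (c : ℂ) (m : ℕ) (x y : R) : R :=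
  ∑ r ∈ Finset.range (m + 1), ((-1) ^ r * qBinomial c m r) • (x ^ (m - r) * y * x ^ r)

/-- The defining relations of `U_q(𝔤)`; here `q_i = q ^ d_i`. -/
inductive Rel (A : Matrix ι ι ℤ) (d : ι → ℕ) (q : ℂ) :
    FreeAlgebra ℂ (Gen ι) → FreeAlgebra ℂ (Gen ι) → Prop
  | K_Kinv (i : ι) : Rel A d q (gen (.K i) * gen (.Kinv i)) 1
  | Kinv_K (i : ι) : Rel A d q (gen (.Kinv i) * gen (.K i)) 1
  | K_K (i j : ι) : Rel A d q (gen (.K i) * gen (.K j)) (gen (.K j) * gen (.K i))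
  | K_E (i j : ι) : Rel A d q (gen (.K i) * gen (.E j) * gen (.Kinv i))
      (((q ^ d i) ^ (A i j)) • gen (.E j))
  | K_F (i j : ι) : Rel A d q (gen (.K i) * gen (.F j) * gen (.Kinv i))
      (((q ^ d i) ^ (-A i j)) • gen (.F j))
  | E_F (i j : ι) : Rel A d q (gen (.E i) * gen (.F j) - gen (.F j) * gen (.E i))
      (if i = j then (q ^ d i - (q ^ d i)⁻¹)⁻¹ • (gen (.K i) - gen (.Kinv i)) else 0)
  | serre_E (i j : ι) (h : i ≠ j) :
      Rel A d q (serre (q ^ d i) (1 - A i j).toNat (gen (.E i)) (gen (.E j))) 0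
  | serre_F (i j : ι) (h : i ≠ j) :
      Rel A d q (serre (q ^ d i) (1 - A i j).toNat (gen (.F i)) (gen (.F j))) 0

end Relations

variable {ι : Type*} [DecidableEq ι] (A : Matrix ι ι ℤ) (d : ι → ℕ) (q : ℂ)

/-- The quantized enveloping algebra `U = U_q(𝔤)`. -/
def U : Type _ := RingQuot (Rel A d q)

instance : Ring (U A d q) := inferInstanceAs (Ring (RingQuot (Rel A d q)))

instance : Algebra ℂ (U A d q) := inferInstanceAs (Algebra ℂ (RingQuot (Rel A d q)))

/-- The class of a generator in `U`. -/
def mk (g : Gen ι) : U A d q := RingQuot.mkAlgHom ℂ (Rel A d q) (gen g)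

def E (i : ι) : U A d q := mk A d q (.E i)

def F (i : ι) : U A d q := mk A d q (.F i)

def K (i : ι) : U A d q := mk A d q (.K i)

def Kinv (i : ι) : U A d q := mk A d q (.Kinv i)

theorem K_mul_Kinv (i : ι) : K A d q i * Kinv A d q i = 1 := by
  have h := RingQuot.mkAlgHom_rel ℂ (Rel.K_Kinv (A := A) (d := d) (q := q) i)
  rw [map_mul, map_one] at h
  exact h

theorem Kinv_mul_K (i : ι) : Kinv A d q i * K A d q i = 1 := by
  have h := RingQuot.mkAlgHom_rel ℂ (Rel.Kinv_K (A := A) (d := d) (q := q) i)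
  rw [map_mul, map_one] at h
  exact h

/-- `U⁺`, the subalgebra generated by the `E_i`. -/
def Uplus : Subalgebra ℂ (U A d q) := Algebra.adjoin ℂ (Set.range (E A d q))

/-- `U⁻`, the subalgebra generated by the `F_i`. -/
def Uminus : Subalgebra ℂ (U A d q) := Algebra.adjoin ℂ (Set.range (F A d q))

/-- `U⁰` (upper index), the subalgebra generated by the `K_i` and their inverses. -/
def Ucartan : Subalgebra ℂ (U A d q) :=
  Algebra.adjoin ℂ (Set.range (K A d q) ∪ Set.range (Kinv A d q))

section Weights

variable [Fintype ι]

/-- The integer `(α_i, γ)` for `γ = ∑_j γ_j α_j` in the root lattice `Q`, which is identified with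
`ι → ℤ`; thus `(α_i, α_j) = d_i a_{ij}`. -/
def rootPairing (i : ι) (γ : ι → ℤ) : ℤ := ∑ j, (d i : ℤ) * A i j * γ j

/-- The root subspace `U_γ` of all `X` with `K_i X K_i⁻¹ = q ^ (α_i, γ) X` for all `i`. -/
def weightSpace (γ : ι → ℤ) : Submodule ℂ (U A d q) where
  carrier := {X | ∀ i, K A d q i * X * Kinv A d q i = (q ^ rootPairing A d i γ) • X}
  add_mem' := fun {X Y} hX hY i => by rw [mul_add, add_mul, hX i, hY i, smul_add]
  zero_mem' := fun i => by simp
  smul_mem' := fun c X hX i => by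
    rw [mul_smul_comm, smul_mul_assoc, hX i, smul_comm]

/-- `U⁺_γ`. -/
def UplusWeight (γ : ι → ℤ) : Submodule ℂ (U A d q) :=
  Subalgebra.toSubmodule (Uplus A d q) ⊓ weightSpace A d q γ

/-- `U⁻_γ`. -/
def UminusWeight (γ : ι → ℤ) : Submodule ℂ (U A d q) :=
  Subalgebra.toSubmodule (Uminus A d q) ⊓ weightSpace A d q γ

/-- `U_{γ,σ} = U⁺_σ U⁰ U⁻_{γ - σ}`, the part of `U_γ` with E-root `σ`. -/
def component (γ σ : ι → ℤ) : Submodule ℂ (U A d q) :=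
  UplusWeight A d q σ * Subalgebra.toSubmodule (Ucartan A d q) * UminusWeight A d q (γ - σ)

/-- The centralizer `U_0` (lower index) of `U⁰`, i.e. the root subspace `U_γ` for `γ = 0`. -/
def Uzero : Subalgebra ℂ (U A d q) where
  carrier := {X | X ∈ weightSpace A d q 0}
  mul_mem' := fun {X Y} hX hY i => by
    have hX' := hX i
    have hY' := hY i
    simp only [rootPairing, Pi.zero_apply, mul_zero, Finset.sum_const_zero, zpow_zero,
      one_smul] at hX' hY' ⊢
    calc K A d q i * (X * Y) * Kinv A d q i
        = K A d q i * X * (Kinv A d q i * K A d q i) * Y * Kinv A d q i := by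
          rw [Kinv_mul_K]; simp only [mul_assoc, one_mul]
      _ = (K A d q i * X * Kinv A d q i) * (K A d q i * Y * Kinv A d q i) := by
          simp only [mul_assoc]
      _ = X * Y := by rw [hX', hY']
  add_mem' := fun hX hY => (weightSpace A d q 0).add_mem hX hY
  algebraMap_mem' := fun c i => by
    simp only [rootPairing, Pi.zero_apply, mul_zero, Finset.sum_const_zero, zpow_zero, one_smul]
    rw [← Algebra.commutes, mul_assoc, K_mul_Kinv, mul_one]

/-- `Q⁺_S`: the elements of `Q⁺` that only involve the simple roots `α_i`, `i ∈ S`. -/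
def QplusOf (S : Set ι) : Set (ι → ℤ) := {γ | (∀ i, 0 ≤ γ i) ∧ ∀ i, i ∉ S → γ i = 0}

/-- The complement of `Q⁺_S` in `Q⁺`. -/
def QplusCompl (S : Set ι) : Set (ι → ℤ) := {γ | (∀ i, 0 ≤ γ i) ∧ ∃ i, i ∉ S ∧ 0 < γ i}

/-- `U_0^S`, the sum of the `U_{0,γ}` over `γ ∈ Q⁺_S`. -/
def UzeroOf (S : Set ι) : Submodule ℂ (U A d q) := ⨆ γ ∈ QplusOf S, component A d q 0 γ

/-- `I^S`, the sum of the `U_{0,γ}` over `γ ∈ Q⁺ \ Q⁺_S`. -/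
def idealOf (S : Set ι) : Submodule ℂ (U A d q) := ⨆ γ ∈ QplusCompl S, component A d q 0 γ

end Weights

end QuantumEnveloping

end

/-! Everything except directness is straightening. Moving `F`'s to the right of `E`'s writes U as
the span of the products E_u k F_v, with u, v words in the simple roots and k in U⁰, and each
exchange removes the same weight from both words (`Fword_mul_Eword_mem`). Independence of the weight
spaces then shows that U_0 is spanned by the products with wt u = wt v, hence that U_0 = U_0^S +
I^S. If two such products of E-weights σ and τ are multiplied, only E-weights ρ with σ ≤ ρ, τ ≤ ρ
and ρ ≤ σ + τ occur (`mul_mem_of_triangularSpan₂`). The lower bounds make I^S an ideal of U_0, the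
upper bound makes U_0^S a subalgebra.

Over the orthogonal set S the Serre relations say that the E_i commute, and likewise the F_i. So E_u
k F_v only depends on weights and k, and it is rewritten in terms of the E_iF_i and U⁰
(`adjoin_leviGenerators`); these generators commute.

Directness needs modules in which elements of U can be seen to be nonzero. For each integral l,
`exists_lowestWeightModule` gives a representation with a nonzero vector v killed by all F_i and
with K_i v = q^(l_i) v. If a nonzero sum of components with weights in Q⁺_S lies in I^S, choose a
minimal weight γ = wt u that occurs and apply the sum to E_u v. A product E_a k F_b kills E_u v
unless wt b ≤ wt u (`triangularSpan_apply_eq_zero`), so I^S and all components but that of γ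
contribute nothing. The remaining component is E_u k F_u, and F_u E_u v = c v with c ≠ 0 when all
l_i ≥ 1 (`exists_Fword_Eword_apply`, a rank one computation because S is orthogonal). Hence k acts
by zero on v for all such l, and k = 0 by linear independence of characters (`exists_eval_Ucartan`).

Given the decomposition, a character of U_0^S extends by zero on I^S (`exists_algHom_extension`). -/

noncomputable section

namespace QuantumEnveloping

/-! ### Identities for q-binomial coefficients. -/

section QNumbers

variable {c : ℂ}

theorem qNumber_zero : qNumber c 0 = 0 := by simp [qNumber]

theorem sub_inv_ne_zero (hc0 : c ≠ 0) (hc : ∀ n : ℕ, 0 < n → c ^ n ≠ 1) {n : ℕ} (hn : 0 < n) :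
    c ^ n - (c ^ n)⁻¹ ≠ 0 := by
  intro h
  have h1 : c ^ n ≠ 0 := pow_ne_zero _ hc0
  apply hc (n + n) (by omega)
  rw [pow_add]
  nth_rewrite 1 [sub_eq_zero.mp h]
  exact inv_mul_cancel₀ h1

theorem qNumber_ne_zero (hc0 : c ≠ 0) (hc : ∀ n : ℕ, 0 < n → c ^ n ≠ 1) {n : ℕ} (hn : 0 < n) :
    qNumber c n ≠ 0 := by
  have := sub_inv_ne_zero hc0 hc one_pos
  rw [pow_one] at this
  exact div_ne_zero (sub_inv_ne_zero hc0 hc hn) this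

theorem qFactorial_succ (n : ℕ) : qFactorial c (n + 1) = qFactorial c n * qNumber c (n + 1) := by
  rw [qFactorial, Finset.prod_Icc_succ_top (by omega)]
  rfl

theorem qFactorial_ne_zero (hc0 : c ≠ 0) (hc : ∀ n : ℕ, 0 < n → c ^ n ≠ 1) (n : ℕ) :
    qFactorial c n ≠ 0 :=
  Finset.prod_ne_zero_iff.mpr fun j hj => qNumber_ne_zero hc0 hc (by simp at hj; omega)

theorem qBinomial_zero_right (hc0 : c ≠ 0) (hc : ∀ n : ℕ, 0 < n → c ^ n ≠ 1) (n : ℕ) :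
    qBinomial c n 0 = 1 := by
  have := qFactorial_ne_zero hc0 hc n
  have h0 : qFactorial c 0 = 1 := by simp [qFactorial]
  simp [qBinomial, h0, this]

theorem qBinomial_self (hc0 : c ≠ 0) (hc : ∀ n : ℕ, 0 < n → c ^ n ≠ 1) (n : ℕ) :
    qBinomial c n n = 1 := by
  have := qFactorial_ne_zero hc0 hc n
  have h0 : qFactorial c 0 = 1 := by simp [qFactorial]
  simp [qBinomial, h0, this]

theorem qBinomial_mul_qNumber (hc0 : c ≠ 0) (hc : ∀ n : ℕ, 0 < n → c ^ n ≠ 1) {n r : ℕ}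
    (hr : r ≤ n) : qBinomial c (n + 1) r * qNumber c (n - r + 1) =
      qBinomial c (n + 1) (r + 1) * qNumber c (r + 1) := by
  have h1 := qFactorial_ne_zero hc0 hc r
  have h2 := qFactorial_ne_zero hc0 hc (n - r)
  have h3 := qNumber_ne_zero hc0 hc (Nat.succ_pos r)
  have h4 := qNumber_ne_zero hc0 hc (Nat.succ_pos (n - r))
  have e1 : n + 1 - r = n - r + 1 := by omega
  have e2 : n + 1 - (r + 1) = n - r := by omega
  rw [qBinomial, qBinomial, e1, e2, qFactorial_succ (n - r), qFactorial_succ r]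
  simp only [Nat.succ_eq_add_one] at h3 h4
  field_simp

/-- The `q`-Pascal rule. -/
theorem qBinomial_succ_succ (hc0 : c ≠ 0) (hc : ∀ n : ℕ, 0 < n → c ^ n ≠ 1) {n r : ℕ}
    (hr : r < n) : qBinomial c (n + 1) (r + 1) =
      c ^ (r + 1) * qBinomial c n (r + 1) + (c ^ (n - r))⁻¹ * qBinomial c n r := by
  obtain ⟨k, rfl⟩ : ∃ k, n = r + k + 1 := ⟨n - r - 1, by omega⟩
  have h1 := qFactorial_ne_zero hc0 hc r
  have h2 := qFactorial_ne_zero hc0 hc k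
  have h3 := qNumber_ne_zero hc0 hc (Nat.succ_pos r)
  have h4 := qNumber_ne_zero hc0 hc (Nat.succ_pos k)
  have h5 := sub_inv_ne_zero hc0 hc one_pos
  have e1 : r + k + 1 + 1 - (r + 1) = k + 1 := by omega
  have e2 : r + k + 1 - (r + 1) = k := by omega
  have e3 : r + k + 1 - r = k + 1 := by omega
  have key : qNumber c (r + k + 1 + 1) =
      c ^ (r + 1) * qNumber c (k + 1) + (c ^ (k + 1))⁻¹ * qNumber c (r + 1) := by
    simp only [qNumber]
    rw [pow_one] at h5
    field_simp
    ring
  simp only [qBinomial, e1, e2, e3, qFactorial_succ (r + k + 1), qFactorial_succ r,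
    qFactorial_succ k, key]
  simp only [Nat.succ_eq_add_one] at h3 h4
  field_simp

/-- The mirror of the previous rule under c ↦ c⁻¹. Each of the two makes one of the alternating sums
below telescope. -/
theorem qBinomial_succ_succ' (hc0 : c ≠ 0) (hc : ∀ n : ℕ, 0 < n → c ^ n ≠ 1) {n r : ℕ}
    (hr : r < n) : qBinomial c (n + 1) (r + 1) =
      (c ^ (r + 1))⁻¹ * qBinomial c n (r + 1) + c ^ (n - r) * qBinomial c n r := by
  obtain ⟨k, rfl⟩ : ∃ k, n = r + k + 1 := ⟨n - r - 1, by omega⟩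
  have h1 := qFactorial_ne_zero hc0 hc r
  have h2 := qFactorial_ne_zero hc0 hc k
  have h3 := qNumber_ne_zero hc0 hc (Nat.succ_pos r)
  have h4 := qNumber_ne_zero hc0 hc (Nat.succ_pos k)
  have h5 := sub_inv_ne_zero hc0 hc one_pos
  have e1 : r + k + 1 + 1 - (r + 1) = k + 1 := by omega
  have e2 : r + k + 1 - (r + 1) = k := by omega
  have e3 : r + k + 1 - r = k + 1 := by omega
  have key : qNumber c (r + k + 1 + 1) =
      (c ^ (r + 1))⁻¹ * qNumber c (k + 1) + c ^ (k + 1) * qNumber c (r + 1) := by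
    simp only [qNumber]
    rw [pow_one] at h5
    field_simp
    ring
  simp only [qBinomial, e1, e2, e3, qFactorial_succ (r + k + 1), qFactorial_succ r,
    qFactorial_succ k, key]
  simp only [Nat.succ_eq_add_one] at h3 h4
  field_simp

/-- Telescoping: the partial sum up to m ≤ n is (-1)^m g(m), and the last term cancels it. -/
theorem alternating_sum_of_pascal {f g : ℕ → ℂ} {n : ℕ} (h0 : f 0 = g 0) (hn : f (n + 1) = g n)
    (hs : ∀ r < n, f (r + 1) = g (r + 1) + g r) :
    ∑ r ∈ Finset.range (n + 2), (-1) ^ r * f r = 0 := by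
  have key : ∀ m ≤ n, ∑ r ∈ Finset.range (m + 1), (-1) ^ r * f r = (-1) ^ m * g m := by
    intro m
    induction m with
    | zero => intro _; simp [h0]
    | succ m ih =>
      intro hm
      rw [Finset.sum_range_succ, ih (by omega), hs m (by omega)]
      ring
  rw [Finset.sum_range_succ, key n le_rfl, hn]
  ring

/-- The q-binomial theorem evaluated at one of the zeros c^n of its product side;
`sum_qBinomial_inv_pow` is the opposite zero. -/
theorem sum_qBinomial_pow (hc0 : c ≠ 0) (hc : ∀ n : ℕ, 0 < n → c ^ n ≠ 1) (n : ℕ) :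
    ∑ r ∈ Finset.range (n + 2), (-1) ^ r * (qBinomial c (n + 1) r * (c ^ n) ^ r) = 0 := by
  apply alternating_sum_of_pascal (g := fun r => c ^ r * (c ^ n) ^ r * qBinomial c n r)
  · simp [qBinomial_zero_right hc0 hc]
  · simp only [qBinomial_self hc0 hc]
    ring
  · intro r hr
    rw [qBinomial_succ_succ hc0 hc hr]
    obtain ⟨k, rfl⟩ : ∃ k, n = r + k := ⟨n - r, by omega⟩
    rw [Nat.add_sub_cancel_left]
    field_simp
    ring

theorem sum_qBinomial_inv_pow (hc0 : c ≠ 0) (hc : ∀ n : ℕ, 0 < n → c ^ n ≠ 1) (n : ℕ) :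
    ∑ r ∈ Finset.range (n + 2), (-1) ^ r * (qBinomial c (n + 1) r * ((c ^ n)⁻¹) ^ r) = 0 := by
  apply alternating_sum_of_pascal (g := fun r => (c ^ r)⁻¹ * ((c ^ n)⁻¹) ^ r * qBinomial c n r)
  · simp [qBinomial_zero_right hc0 hc]
  · simp only [qBinomial_self hc0 hc, inv_pow]
    field_simp
    ring
  · intro r hr
    rw [qBinomial_succ_succ' hc0 hc hr]
    obtain ⟨k, rfl⟩ : ∃ k, n = r + k := ⟨n - r, by omega⟩
    rw [Nat.add_sub_cancel_left]
    simp only [inv_pow]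
    field_simp
    ring

end QNumbers

/-! ### The Serre expression commutes with lowering operators. -/

section SerreCommute

variable {R : Type*} [Ring R] [Algebra ℂ R] {c : ℂ} {e f y k k' : R}

theorem mul_pow_of_mul_eq_smul {a : ℂ} (h : k * e = a • (e * k)) (n : ℕ) :
    k * e ^ n = a ^ n • (e ^ n * k) := by
  induction n with
  | zero => simp
  | succ n ih =>
    rw [pow_succ, ← mul_assoc, ih, smul_mul_assoc, mul_assoc, h, mul_smul_comm, smul_smul,
      mul_assoc, ← pow_succ]

theorem serre_commute_of_commute (m : ℕ) (he : Commute e y) (hf : Commute f y) :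
    Commute (serre c m e f) y := by
  refine Commute.sum_left _ _ _ fun r _ => Commute.smul_left ?_ _
  exact ((he.pow_left _).mul_left hf).mul_left (he.pow_left _)

/-- Here y is the partner of the letter f that occurs once. The commutator with the r-th term is a
combination of e^(n+1) k and e^(n+1) k', with extra factors c^(-nr) and c^(nr); summing over r
yields the two vanishing q-binomial sums. -/
theorem serre_commute_of_commutator_right (hc0 : c ≠ 0) (hc : ∀ n : ℕ, 0 < n → c ^ n ≠ 1)
    (n : ℕ) (s : ℂ) (he : Commute e y) (hf : f * y = y * f + s • (k - k'))
    (hk : k * e = (c ^ n)⁻¹ • (e * k)) (hk' : k' * e = c ^ n • (e * k')) :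
    Commute (serre c (n + 1) e f) y := by
  have key : ∀ r ∈ Finset.range (n + 2),
      ((-1) ^ r * qBinomial c (n + 1) r) • (e ^ (n + 1 - r) * f * e ^ r) * y =
      y * ((-1) ^ r * qBinomial c (n + 1) r) • (e ^ (n + 1 - r) * f * e ^ r) +
      s • (((-1) ^ r * (qBinomial c (n + 1) r * ((c ^ n)⁻¹) ^ r)) • (e ^ (n + 1) * k) -
        ((-1) ^ r * (qBinomial c (n + 1) r * (c ^ n) ^ r)) • (e ^ (n + 1) * k')) := by
    intro r hr
    have hr' : n + 1 - r + r = n + 1 := by simp at hr; omega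
    have h1 : e ^ (n + 1 - r) * f * e ^ r * y = y * (e ^ (n + 1 - r) * f * e ^ r) +
        s • (((c ^ n)⁻¹) ^ r • (e ^ (n + 1) * k) - (c ^ n) ^ r • (e ^ (n + 1) * k')) := by
      calc e ^ (n + 1 - r) * f * e ^ r * y = e ^ (n + 1 - r) * (f * y) * e ^ r := by
            rw [mul_assoc _ _ y, (he.pow_left r).eq]; simp only [mul_assoc]
        _ = e ^ (n + 1 - r) * y * f * e ^ r +
            s • (e ^ (n + 1 - r) * (k * e ^ r - k' * e ^ r)) := by
            rw [hf]; simp only [mul_add, add_mul, mul_smul_comm, smul_mul_assoc, mul_assoc, sub_mul]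
        _ = _ := by
            rw [mul_pow_of_mul_eq_smul hk, mul_pow_of_mul_eq_smul hk', (he.pow_left _).eq, mul_sub,
              mul_smul_comm, mul_smul_comm, ← mul_assoc, ← mul_assoc (_ ^ (n + 1 - r)) (_ ^ r),
              ← pow_add, hr']
            simp only [mul_assoc]
    rw [smul_mul_assoc, h1, mul_smul_comm, smul_add, smul_comm _ s]
    simp only [smul_sub, smul_smul, mul_assoc]
  rw [Commute, SemiconjBy, serre, Finset.sum_mul, Finset.mul_sum, Finset.sum_congr rfl key,
    Finset.sum_add_distrib, ← Finset.smul_sum, Finset.sum_sub_distrib, ← Finset.sum_smul,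
    ← Finset.sum_smul, sum_qBinomial_pow hc0 hc, sum_qBinomial_inv_pow hc0 hc]
  simp

/-- The rank one formula for the commutator of a power of E with F. -/
theorem pow_mul_of_commutator (hc0 : c ≠ 0) (hc : ∀ n : ℕ, 0 < n → c ^ n ≠ 1) {s : ℂ}
    (he : e * y = y * e + s • (k - k')) (hk : k * e = c ^ 2 • (e * k))
    (hk' : k' * e = (c ^ 2)⁻¹ • (e * k')) (n : ℕ) :
    e ^ (n + 1) * y = y * e ^ (n + 1) +
      (s * qNumber c (n + 1)) • (e ^ n * (c ^ n • k - (c ^ n)⁻¹ • k')) := by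
  have h5 := sub_inv_ne_zero hc0 hc one_pos
  rw [pow_one] at h5
  have h6 : c ^ 2 - 1 ≠ 0 := sub_ne_zero.mpr (hc 2 two_pos)
  induction n with
  | zero => simp [he, qNumber, div_self h5]
  | succ n ih =>
    have a1 : c ^ (n + 1) * qNumber c (n + 1 + 1) =
        (c ^ 2) ^ (n + 1) + c ^ n * qNumber c (n + 1) := by
      simp only [qNumber]; field_simp; ring
    have a2 : (c ^ (n + 1))⁻¹ * qNumber c (n + 1 + 1) =
        ((c ^ 2)⁻¹) ^ (n + 1) + (c ^ n)⁻¹ * qNumber c (n + 1) := by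
      simp only [qNumber, inv_pow]; field_simp; ring
    calc e ^ (n + 1 + 1) * y = e * (e ^ (n + 1) * y) := by rw [pow_succ' e (n + 1), mul_assoc]
      _ = e * y * e ^ (n + 1) + (s * qNumber c (n + 1)) •
          (e ^ (n + 1) * (c ^ n • k - (c ^ n)⁻¹ • k')) := by
          rw [ih, mul_add, mul_smul_comm, pow_succ' e n]; simp only [mul_assoc]
      _ = y * e ^ (n + 1 + 1) + (s • (k * e ^ (n + 1) - k' * e ^ (n + 1)) +
          (s * qNumber c (n + 1)) • (e ^ (n + 1) * (c ^ n • k - (c ^ n)⁻¹ • k'))) := by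
          rw [he, add_mul, smul_mul_assoc, sub_mul, mul_assoc y, ← pow_succ', add_assoc]
      _ = _ := by
          congr 1
          rw [mul_pow_of_mul_eq_smul hk, mul_pow_of_mul_eq_smul hk']
          simp only [mul_sub, smul_sub, mul_smul_comm, smul_smul]
          rw [mul_assoc s, mul_assoc s, mul_assoc s, mul_assoc s, mul_comm (qNumber c (n + 1 + 1)),
            a1, mul_comm (qNumber c (n + 1 + 1)), a2]
          module

/-- Here y is the partner of the repeated letter e. Each term yields a commutator from the left
power of e and one from the right power; the left one of index r cancels the right one of index r +
1 by `qBinomial_mul_qNumber`. -/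
theorem serre_commute_of_commutator_left (hc0 : c ≠ 0) (hc : ∀ n : ℕ, 0 < n → c ^ n ≠ 1)
    (n : ℕ) (s : ℂ) (he : e * y = y * e + s • (k - k')) (hf : Commute f y)
    (hk : k * e = c ^ 2 • (e * k)) (hk' : k' * e = (c ^ 2)⁻¹ • (e * k'))
    (hkf : k * f = (c ^ n)⁻¹ • (f * k)) (hkf' : k' * f = c ^ n • (f * k')) :
    Commute (serre c (n + 1) e f) y := by
  -- `X r` is the commutator of e^r with y. The truncated `r - 1` is harmless at `r = 0` because the
  -- 0-th q-number is zero.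
  obtain ⟨X, hX⟩ : ∃ X : ℕ → R, ∀ r, X r =
    (s * qNumber c r) • (e ^ (r - 1) * (c ^ (r - 1) • k - (c ^ (r - 1))⁻¹ • k')) := ⟨_, fun _ => rfl⟩
  have hX0 : X 0 = 0 := by simp [hX, qNumber_zero]
  have hpow : ∀ r, e ^ r * y = y * e ^ r + X r := by
    rintro (_ | r)
    · simp [hX0]
    · rw [pow_mul_of_commutator hc0 hc he hk hk', hX]; rfl
  have key : ∀ r,
      ((-1) ^ r * qBinomial c (n + 1) r) • (e ^ (n + 1 - r) * f * e ^ r) * y =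
      y * ((-1) ^ r * qBinomial c (n + 1) r) • (e ^ (n + 1 - r) * f * e ^ r) +
      (((-1) ^ r * qBinomial c (n + 1) r) • (X (n + 1 - r) * f * e ^ r) +
       ((-1) ^ r * qBinomial c (n + 1) r) • (e ^ (n + 1 - r) * f * X r)) := by
    intro r
    rw [smul_mul_assoc, mul_smul_comm, ← smul_add, ← smul_add]
    congr 1
    calc e ^ (n + 1 - r) * f * e ^ r * y
        = e ^ (n + 1 - r) * (f * y) * e ^ r + e ^ (n + 1 - r) * f * X r := by
          rw [mul_assoc _ _ y, hpow, mul_add]; simp only [mul_assoc]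
      _ = (e ^ (n + 1 - r) * y) * f * e ^ r + e ^ (n + 1 - r) * f * X r := by
          rw [hf.eq]; simp only [mul_assoc]
      _ = _ := by rw [hpow]; simp only [add_mul, mul_assoc, add_assoc]
  -- `X 0 = 0` removes the last term of the left sum and the first term of the right sum, so that
  -- the two can be matched after a shift by one.
  rw [Commute, SemiconjBy, serre, Finset.sum_mul, Finset.mul_sum,
    Finset.sum_congr rfl fun r _ => key r, Finset.sum_add_distrib, Finset.sum_add_distrib,
    Finset.sum_range_succ (fun r => _ • (X _ * f * e ^ r)),
    Finset.sum_range_succ' (fun r => _ • (e ^ _ * f * X r)), Nat.sub_self, hX0]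
  simp only [zero_mul, mul_zero, smul_zero, add_zero]
  rw [← Finset.sum_add_distrib, add_eq_left]
  refine Finset.sum_eq_zero ?_
  intro r hr
  have hr' : r ≤ n := by simp at hr; omega
  have e1 : n + 1 - r = n - r + 1 := by omega
  have e2 : n + 1 - (r + 1) = n - r := by omega
  rw [e1, e2, hX, hX, Nat.add_sub_cancel, Nat.add_sub_cancel]
  have h1 : (c ^ (n - r) • k - (c ^ (n - r))⁻¹ • k') * f * e ^ r =
      f * e ^ r * (c ^ r • k - (c ^ r)⁻¹ • k') := by
    obtain ⟨m, rfl⟩ : ∃ m, n = r + m := ⟨n - r, by omega⟩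
    rw [Nat.add_sub_cancel_left]
    simp only [sub_mul, smul_mul_assoc, hkf, hkf', mul_sub, mul_smul_comm]
    rw [mul_assoc f k, mul_assoc f k', mul_pow_of_mul_eq_smul hk, mul_pow_of_mul_eq_smul hk']
    simp only [mul_smul_comm, smul_smul, mul_assoc]
    congr 2
    · field_simp
      ring
    · simp only [inv_pow]
      field_simp
      ring
  have h2 : (s * qNumber c (n - r + 1)) •
      (e ^ (n - r) * (c ^ (n - r) • k - (c ^ (n - r))⁻¹ • k')) * f * e ^ r =
      (s * qNumber c (n - r + 1)) • (e ^ (n - r) * (f * e ^ r * (c ^ r • k - (c ^ r)⁻¹ • k'))) := by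
    rw [← h1]; simp only [smul_mul_assoc, mul_assoc]
  rw [h2]
  simp only [mul_smul_comm, smul_smul, mul_assoc, ← add_smul]
  have h3 := qBinomial_mul_qNumber hc0 hc hr'
  rw [show (-1) ^ r * (qBinomial c (n + 1) r * (s * qNumber c (n - r + 1))) +
      (-1) ^ (r + 1) * (qBinomial c (n + 1) (r + 1) * (s * qNumber c (r + 1))) = 0 by
    rw [pow_succ]; linear_combination (-1) ^ r * s * h3, zero_smul]

end SerreCommute

/-! ### Consequences of the relations other than the Serre relations. -/

section PreRelations

variable {ι : Type*} [DecidableEq ι] {R : Type*} [Ring R] [Algebra ℂ R]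

/-- The defining relations of `U_q(𝔤)` other than the `q`-Serre relations. -/
structure IsPreRep (A : Matrix ι ι ℤ) (d : ι → ℕ) (q : ℂ) (e f k k' : ι → R) : Prop where
  k_k' : ∀ i, k i * k' i = 1
  k'_k : ∀ i, k' i * k i = 1
  k_k : ∀ i j, k i * k j = k j * k i
  k_e : ∀ i j, k i * e j = (q ^ d i) ^ A i j • (e j * k i)
  k_f : ∀ i j, k i * f j = (q ^ d i) ^ (-A i j) • (f j * k i)
  e_f : ∀ i j, e i * f j - f j * e i =
    if i = j then (q ^ d i - (q ^ d i)⁻¹)⁻¹ • (k i - k' i) else 0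

variable {A : Matrix ι ι ℤ} {d : ι → ℕ} {q : ℂ} {e f k k' : ι → R}

theorem inv_mul_eq_smul_of_mul_eq_smul {x y y' : R} {a : ℂ} (ha : a ≠ 0) (h1 : y * y' = 1)
    (h2 : y' * y = 1) (h : y * x = a • (x * y)) : y' * x = a⁻¹ • (x * y') := by
  have : y' * (y * x) * y' = y' * (a • (x * y)) * y' := by rw [h]
  rw [← mul_assoc, h2, one_mul, mul_smul_comm, smul_mul_assoc, mul_assoc, mul_assoc x, h1,
    mul_one] at this
  rw [this, smul_smul, inv_mul_cancel₀ ha, one_smul]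

namespace IsPreRep

theorem k'_e (h : IsPreRep A d q e f k k') (hq : q ≠ 0) (i j : ι) :
    k' i * e j = (q ^ d i) ^ (-A i j) • (e j * k' i) := by
  rw [zpow_neg]
  exact inv_mul_eq_smul_of_mul_eq_smul (zpow_ne_zero _ (pow_ne_zero _ hq)) (h.k_k' i) (h.k'_k i)
    (h.k_e i j)

theorem k'_f (h : IsPreRep A d q e f k k') (hq : q ≠ 0) (i j : ι) :
    k' i * f j = (q ^ d i) ^ A i j • (f j * k' i) := by
  have := inv_mul_eq_smul_of_mul_eq_smul (zpow_ne_zero _ (pow_ne_zero _ hq)) (h.k_k' i) (h.k'_k i)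
    (h.k_f i j)
  rwa [zpow_neg, inv_inv] at this

theorem k'_k' (h : IsPreRep A d q e f k k') (i j : ι) : k' i * k' j = k' j * k' i := by
  have hu (i : ι) : ∃ u : Rˣ, (u : R) = k i ∧ ((u⁻¹ : Rˣ) : R) = k' i :=
    ⟨⟨k i, k' i, h.k_k' i, h.k'_k i⟩, rfl, rfl⟩
  obtain ⟨u, hu1, hu2⟩ := hu i
  obtain ⟨v, hv1, hv2⟩ := hu j
  have h1 : Commute (u : R) v := by rw [hu1, hv1]; exact h.k_k i j
  rw [← hu2, ← hv2]
  exact h1.units_inv_left.units_inv_right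

/-- The symmetry exchanging the positive and the negative part. -/
theorem swap (h : IsPreRep A d q e f k k') (hq : q ≠ 0) : IsPreRep A d q f e k' k where
  k_k' := h.k'_k
  k'_k := h.k_k'
  k_k := h.k'_k'
  k_e := h.k'_f hq
  k_f := h.k'_e hq
  e_f i j := by
    rw [← neg_sub, h.e_f]
    by_cases hij : i = j
    · subst hij
      simp only [if_true, ← smul_neg, neg_sub]
    · simp [hij, Ne.symm hij]

theorem serre_commute (h : IsPreRep A d q e f k k') (hq0 : q ≠ 0)
    (hq : ∀ n : ℕ, 0 < n → q ^ n ≠ 1) (hdiag : ∀ i, A i i = 2)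
    (hoff : ∀ i j, i ≠ j → A i j ≤ 0) (hd : ∀ i, 0 < d i)
    (hsymm : ∀ i j, (d i : ℤ) * A i j = (d j : ℤ) * A j i) {i j : ι} (hij : i ≠ j) (a : ι) :
    Commute (serre (q ^ d i) (1 - A i j).toNat (e i) (e j)) (f a) := by
  obtain ⟨n, hn⟩ : ∃ n : ℕ, A i j = -n := ⟨(-A i j).toNat, by have := hoff i j hij; omega⟩
  have hm : (1 - A i j).toNat = n + 1 := by omega
  have hc0 : q ^ d i ≠ 0 := pow_ne_zero _ hq0
  have hc : ∀ n : ℕ, 0 < n → (q ^ d i) ^ n ≠ 1 := fun n hn => by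
    rw [← pow_mul]; exact hq _ (Nat.mul_pos (hd i) hn)
  have comm {x y : ι} (hxy : x ≠ y) : Commute (e x) (f y) := by
    have := h.e_f x y
    rwa [if_neg hxy, sub_eq_zero] at this
  have ncomm (x : ι) : e x * f x =
      f x * e x + (q ^ d x - (q ^ d x)⁻¹)⁻¹ • (k x - k' x) := by
    have := h.e_f x x
    rw [if_pos rfl] at this
    rw [← this]; abel
  rw [hm]
  by_cases hai : a = i
  · subst hai
    refine serre_commute_of_commutator_left hc0 hc n _ (ncomm a) (comm hij.symm) ?_ ?_ ?_ ?_
    · rw [h.k_e, hdiag]; rfl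
    · rw [h.k'_e hq0, hdiag, zpow_neg]; rfl
    · rw [h.k_e, hn, zpow_neg, zpow_natCast]
    · rw [h.k'_e hq0, hn, neg_neg, zpow_natCast]
  by_cases haj : a = j
  · subst haj
    -- Symmetry of DA expresses the factor in the base q_i of the Serre relation.
    have hs : (q ^ d a) ^ A a i = (q ^ d i) ^ A i a := by
      rw [← zpow_natCast, ← zpow_natCast, ← zpow_mul, ← zpow_mul, hsymm]
    refine serre_commute_of_commutator_right hc0 hc n _ (comm hij) (ncomm a) ?_ ?_
    · rw [h.k_e, hs, hn, zpow_neg, zpow_natCast]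
    · rw [h.k'_e hq0, zpow_neg, hs, hn, zpow_neg, inv_inv, zpow_natCast]
  · exact serre_commute_of_commute _ (comm (Ne.symm hai)) (comm (Ne.symm haj))

end IsPreRep

end PreRelations

/-- The weight of a word in the simple roots. -/
def wt {ι : Type*} [DecidableEq ι] (u : List ι) : ι → ℤ := fun i => u.count i

/-! ### The root pairing and weights of words. -/

section RootPairing

variable {ι : Type*} [Fintype ι]

theorem rootPairing_add (A : Matrix ι ι ℤ) (d : ι → ℕ) (i : ι) (γ δ : ι → ℤ) :
    rootPairing A d i (γ + δ) = rootPairing A d i γ + rootPairing A d i δ := by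
  simp [rootPairing, mul_add, Finset.sum_add_distrib]

theorem rootPairing_zero (A : Matrix ι ι ℤ) (d : ι → ℕ) (i : ι) :
    rootPairing A d i 0 = 0 := by
  simp [rootPairing]

theorem rootPairing_neg (A : Matrix ι ι ℤ) (d : ι → ℕ) (i : ι) (γ : ι → ℤ) :
    rootPairing A d i (-γ) = -rootPairing A d i γ := by
  simp [rootPairing]

end RootPairing

section Weight

variable {ι : Type*} [DecidableEq ι]

theorem wt_nil : wt ([] : List ι) = 0 := rfl

theorem wt_cons (i : ι) (u : List ι) : wt (i :: u) = Pi.single i 1 + wt u := by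
  ext j
  by_cases h : i = j
  · subst h; simp [wt]; ring
  · simp [wt, h]

theorem wt_append (u v : List ι) : wt (u ++ v) = wt u + wt v := by
  ext j; simp [wt]

theorem wt_nonneg (u : List ι) : 0 ≤ wt u := fun i => by simp [wt]

theorem rootPairing_single [Fintype ι] (A : Matrix ι ι ℤ) (d : ι → ℕ) (i j : ι) :
    rootPairing A d i (Pi.single j 1) = d i * A i j := by
  simp [rootPairing, Pi.single_apply]

end Weight

/-! ### Operators on words: a lowest weight module without the E-Serre relations. -/

namespace Verma

variable {ι : Type*} [Fintype ι] [DecidableEq ι] (A : Matrix ι ι ℤ) (d : ι → ℕ) (q : ℂ)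
  (l : ι → ℤ)

/-- The eigenvalue of `K_i` on the word `u` in the lowest weight module of lowest weight `l`. -/
def eigenvalue (i : ι) (u : List ι) : ℂ := q ^ (l i + rootPairing A d i (wt u))

def opE {ι : Type*} (i : ι) : Module.End ℂ (List ι →₀ ℂ) :=
  Finsupp.linearCombination ℂ fun u => Finsupp.single (i :: u) 1

def opK (i : ι) : Module.End ℂ (List ι →₀ ℂ) :=
  Finsupp.linearCombination ℂ fun u => eigenvalue A d q l i u • Finsupp.single u 1

def opKinv (i : ι) : Module.End ℂ (List ι →₀ ℂ) :=
  Finsupp.linearCombination ℂ fun u => (eigenvalue A d q l i u)⁻¹ • Finsupp.single u 1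

/-- The value of `F_i` on a word, found by moving `F_i` to the right. -/
def lower (i : ι) : List ι → List ι →₀ ℂ
  | [] => 0
  | j :: u => opE j (lower i u) - if j = i then (q ^ d i - (q ^ d i)⁻¹)⁻¹ •
      (opK A d q l i (Finsupp.single u 1) - opKinv A d q l i (Finsupp.single u 1)) else 0

def opF (i : ι) : Module.End ℂ (List ι →₀ ℂ) :=
  Finsupp.linearCombination ℂ (lower A d q l i)

variable {A d q l}

theorem opE_single {ι : Type*} (i : ι) (u : List ι) :
    opE i (Finsupp.single u 1) = Finsupp.single (i :: u) 1 := by simp [opE]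

theorem opK_single (i : ι) (u : List ι) : opK A d q l i (Finsupp.single u 1) =
    eigenvalue A d q l i u • Finsupp.single u 1 := by simp [opK]

theorem opKinv_single (i : ι) (u : List ι) : opKinv A d q l i (Finsupp.single u 1) =
    (eigenvalue A d q l i u)⁻¹ • Finsupp.single u 1 := by simp [opKinv]

theorem opF_single (i : ι) (u : List ι) :
    opF A d q l i (Finsupp.single u 1) = lower A d q l i u := by simp [opF]

theorem eigenvalue_cons (hq0 : q ≠ 0) (i j : ι) (u : List ι) :
    eigenvalue A d q l i (j :: u) = (q ^ d i) ^ A i j * eigenvalue A d q l i u := by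
  rw [eigenvalue, eigenvalue, wt_cons, rootPairing_add, rootPairing_single, ← zpow_natCast,
    ← zpow_mul, ← zpow_add₀ hq0]
  congr 1; ring

theorem eigenvalue_ne_zero (hq0 : q ≠ 0) (i : ι) (u : List ι) : eigenvalue A d q l i u ≠ 0 :=
  zpow_ne_zero _ hq0

theorem end_ext {ι : Type*} {f g : Module.End ℂ (List ι →₀ ℂ)}
    (h : ∀ u, f (Finsupp.single u 1) = g (Finsupp.single u 1)) : f = g :=
  Finsupp.lhom_ext' fun u => LinearMap.ext_ring (h u)

theorem opE_mul_opF (i j : ι) : opE i * opF A d q l j - opF A d q l j * opE i =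
    if i = j then (q ^ d i - (q ^ d i)⁻¹)⁻¹ • (opK A d q l i - opKinv A d q l i) else 0 := by
  refine end_ext fun u => ?_
  rw [LinearMap.sub_apply, Module.End.mul_apply, Module.End.mul_apply, opE_single, opF_single,
    opF_single, lower]
  by_cases h : i = j
  · subst h; simp
  · simp [h]

theorem opK_mul_opE (hq0 : q ≠ 0) (i j : ι) :
    opK A d q l i * opE j = (q ^ d i) ^ A i j • (opE j * opK A d q l i) := by
  refine end_ext fun u => ?_
  rw [LinearMap.smul_apply, Module.End.mul_apply, Module.End.mul_apply, opE_single, opK_single,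
    opK_single, map_smul, opE_single, eigenvalue_cons hq0, smul_smul]

theorem opK_mul_opKinv (hq0 : q ≠ 0) (i : ι) : opK A d q l i * opKinv A d q l i = 1 := by
  refine end_ext fun u => ?_
  rw [Module.End.mul_apply, opKinv_single, map_smul, opK_single, smul_smul,
    inv_mul_cancel₀ (eigenvalue_ne_zero hq0 i u), one_smul, Module.End.one_apply]

theorem opKinv_mul_opK (hq0 : q ≠ 0) (i : ι) : opKinv A d q l i * opK A d q l i = 1 := by
  refine end_ext fun u => ?_
  rw [Module.End.mul_apply, opK_single, map_smul, opKinv_single, smul_smul,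
    mul_inv_cancel₀ (eigenvalue_ne_zero hq0 i u), one_smul, Module.End.one_apply]

theorem opK_mul_opK (i j : ι) :
    opK A d q l i * opK A d q l j = opK A d q l j * opK A d q l i := by
  refine end_ext fun u => ?_
  rw [Module.End.mul_apply, Module.End.mul_apply, opK_single, opK_single, map_smul, map_smul,
    opK_single, opK_single, smul_comm]

theorem opK_mul_opKinv_comm (i j : ι) :
    opK A d q l i * opKinv A d q l j = opKinv A d q l j * opK A d q l i := by
  refine end_ext fun u => ?_
  rw [Module.End.mul_apply, Module.End.mul_apply, opK_single, opKinv_single, map_smul, map_smul,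
    opK_single, opKinv_single, smul_comm]

theorem opF_opE (j k : ι) (y : List ι →₀ ℂ) : opF A d q l j (opE k y) = opE k (opF A d q l j y) -
    if k = j then (q ^ d k - (q ^ d k)⁻¹)⁻¹ • (opK A d q l k y - opKinv A d q l k y) else 0 := by
  have h := LinearMap.congr_fun (opE_mul_opF (A := A) (d := d) (q := q) (l := l) k j) y
  rw [LinearMap.sub_apply, Module.End.mul_apply, Module.End.mul_apply] at h
  rw [eq_sub_iff_add_eq', ← eq_sub_iff_add_eq, h]
  split_ifs <;> rfl

theorem opK_opE (hq0 : q ≠ 0) (i k : ι) (y : List ι →₀ ℂ) : opK A d q l i (opE k y) =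
    (q ^ d i) ^ A i k • opE k (opK A d q l i y) := by
  rw [← Module.End.mul_apply, opK_mul_opE hq0, LinearMap.smul_apply, Module.End.mul_apply]

/-- Induction on the word, through the recursion of `opF` past `opE`. The commutator term commutes
with `opK`, which fits because the factors from E_j and F_j are inverse to each other. -/
theorem opK_mul_opF (hq0 : q ≠ 0) (i j : ι) :
    opK A d q l i * opF A d q l j = (q ^ d i) ^ (-A i j) • (opF A d q l j * opK A d q l i) := by
  refine end_ext fun u => ?_
  induction u with
  | nil =>
    rw [LinearMap.smul_apply, Module.End.mul_apply, Module.End.mul_apply, opK_single, map_smul,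
      opF_single, lower, map_zero, smul_zero, smul_zero]
  | cons k u ih =>
    rw [← opE_single]
    generalize (Finsupp.single u 1 : List ι →₀ ℂ) = x at ih ⊢
    have hKK : opK A d q l i (opK A d q l k x) = opK A d q l k (opK A d q l i x) := by
      rw [← Module.End.mul_apply, opK_mul_opK, Module.End.mul_apply]
    have hKK' : opK A d q l i (opKinv A d q l k x) = opKinv A d q l k (opK A d q l i x) := by
      rw [← Module.End.mul_apply, opK_mul_opKinv_comm, Module.End.mul_apply]
    simp only [LinearMap.smul_apply, Module.End.mul_apply] at ih ⊢
    rw [opF_opE, map_sub, opK_opE hq0, opK_opE hq0, ih, map_smul, map_smul, opF_opE]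
    by_cases h : k = j
    · subst h
      have hz : (q ^ d i) ^ A i k ≠ 0 := zpow_ne_zero _ (pow_ne_zero _ hq0)
      simp only [if_true, map_smul, map_sub, hKK, hKK', smul_sub, smul_smul, zpow_neg]
      rw [mul_comm ((q ^ d i) ^ A i k), inv_mul_cancel₀ hz, ← mul_assoc, inv_mul_cancel₀ hz, one_mul]
    · simp only [if_neg h, map_zero, sub_zero]
      rw [smul_comm]

theorem isPreRep (hq0 : q ≠ 0) : IsPreRep A d q opE (opF A d q l) (opK A d q l)
    (opKinv A d q l) where
  k_k' := opK_mul_opKinv hq0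
  k'_k := opKinv_mul_opK hq0
  k_k := opK_mul_opK
  k_e := opK_mul_opE hq0
  k_f := opK_mul_opF hq0
  e_f := opE_mul_opF

end Verma

/-! ### The radical, and the quotient as a representation of U. -/

namespace Verma

variable {ι : Type*} [Fintype ι] [DecidableEq ι] (A : Matrix ι ι ℤ) (d : ι → ℕ) (q : ℂ)
  (l : ι → ℤ)

/-- The vectors that no word in the `F_i` moves to a vector with nonzero component in lowest
weight. -/
def radical : Submodule ℂ (List ι →₀ ℂ) where
  carrier := {x | ∀ w : List ι, (w.map (opF A d q l)).prod x [] = 0}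
  add_mem' hx hy w := by rw [map_add, Finsupp.add_apply, hx w, hy w, add_zero]
  zero_mem' w := by rw [map_zero, Finsupp.zero_apply]
  smul_mem' a x hx w := by rw [map_smul, Finsupp.smul_apply, hx w, smul_zero]

/-- The operator on the space of words given by a generator of `U`. -/
def opGen : Gen ι → Module.End ℂ (List ι →₀ ℂ)
  | .E i => opE i
  | .F i => opF A d q l i
  | .K i => opK A d q l i
  | .Kinv i => opKinv A d q l i

variable {A d q l}

theorem opE_apply_nil {ι : Type*} (i : ι) (x : List ι →₀ ℂ) : opE i x [] = 0 := by
  induction x using Finsupp.induction_linear with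
  | zero => simp
  | add x y hx hy => rw [map_add, Finsupp.add_apply, hx, hy, add_zero]
  | single u a => simp [opE]

theorem serre_opE_apply_nil {ι : Type*} (c : ℂ) (m : ℕ) (i j : ι) (x : List ι →₀ ℂ) :
    serre c m (opE i) (opE j) x [] = 0 := by
  rw [serre, LinearMap.sum_apply, Finsupp.finsetSum_apply]
  refine Finset.sum_eq_zero fun r _ => ?_
  rw [LinearMap.smul_apply, Finsupp.smul_apply, smul_eq_zero]
  right
  rcases hr : m - r with _ | n
  · rw [pow_zero, one_mul, Module.End.mul_apply, opE_apply_nil]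
  · rw [pow_succ', mul_assoc, mul_assoc, Module.End.mul_apply, opE_apply_nil]

theorem opK_apply_nil (i : ι) (x : List ι →₀ ℂ) :
    opK A d q l i x [] = eigenvalue A d q l i [] * x [] := by
  induction x using Finsupp.induction_linear with
  | zero => simp
  | add x y hx hy => rw [map_add, Finsupp.add_apply, hx, hy, Finsupp.add_apply, mul_add]
  | single u a =>
    by_cases h : u = []
    · subst h; simp [opK, mul_comm]
    · simp [opK, h]

theorem opKinv_apply_nil (i : ι) (x : List ι →₀ ℂ) :
    opKinv A d q l i x [] = (eigenvalue A d q l i [])⁻¹ * x [] := by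
  induction x using Finsupp.induction_linear with
  | zero => simp
  | add x y hx hy => rw [map_add, Finsupp.add_apply, hx, hy, Finsupp.add_apply, mul_add]
  | single u a =>
    by_cases h : u = []
    · subst h; simp [opKinv, mul_comm]
    · simp [opKinv, h]

theorem list_prod_mul_eq_smul {ι R : Type*} [Ring R] [Algebra ℂ R] {f : ι → R} {k : R} {a : ι → ℂ}
    (h : ∀ j, f j * k = a j • (k * f j)) (w : List ι) :
    ∃ b : ℂ, (w.map f).prod * k = b • (k * (w.map f).prod) := by
  induction w with
  | nil => exact ⟨1, by simp⟩
  | cons j w ih =>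
    obtain ⟨b, hb⟩ := ih
    refine ⟨b * a j, ?_⟩
    rw [List.map_cons, List.prod_cons, mul_assoc, hb, mul_smul_comm, ← mul_assoc, h,
      smul_mul_assoc, smul_smul, mul_assoc]

theorem opF_mem_radical (i : ι) {x : List ι →₀ ℂ} (hx : x ∈ radical A d q l) :
    opF A d q l i x ∈ radical A d q l := by
  intro w
  have := hx (w ++ [i])
  rwa [List.map_append, List.prod_append, List.map_singleton, List.prod_singleton,
    Module.End.mul_apply] at this

theorem opK_mem_radical (hq0 : q ≠ 0) (i : ι) {x : List ι →₀ ℂ} (hx : x ∈ radical A d q l) :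
    opK A d q l i x ∈ radical A d q l := by
  intro w
  obtain ⟨b, hb⟩ := list_prod_mul_eq_smul (f := opF A d q l) (k := opK A d q l i)
    (a := fun j => (q ^ d i) ^ A i j) (fun j => by
      have hz : (q ^ d i) ^ A i j ≠ 0 := zpow_ne_zero _ (pow_ne_zero _ hq0)
      rw [opK_mul_opF hq0, smul_smul, zpow_neg, mul_inv_cancel₀ hz, one_smul]) w
  rw [← Module.End.mul_apply, hb, LinearMap.smul_apply, Module.End.mul_apply, Finsupp.smul_apply,
    opK_apply_nil, hx w, mul_zero, smul_zero]

theorem opKinv_mem_radical (hq0 : q ≠ 0) (i : ι) {x : List ι →₀ ℂ} (hx : x ∈ radical A d q l) :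
    opKinv A d q l i x ∈ radical A d q l := by
  intro w
  obtain ⟨b, hb⟩ := list_prod_mul_eq_smul (f := opF A d q l) (k := opKinv A d q l i)
    (a := fun j => (q ^ d i) ^ (-A i j)) (fun j => by
      have hz : (q ^ d i) ^ A i j ≠ 0 := zpow_ne_zero _ (pow_ne_zero _ hq0)
      rw [(isPreRep hq0).k'_f hq0, smul_smul, zpow_neg, inv_mul_cancel₀ hz, one_smul]) w
  rw [← Module.End.mul_apply, hb, LinearMap.smul_apply, Module.End.mul_apply, Finsupp.smul_apply,
    opKinv_apply_nil, hx w, mul_zero, smul_zero]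

/-- The first lowering operator to act is moved past `opE i`. Induction handles the main term, and
the commutator term stays in the radical because the torus preserves it. -/
theorem opE_mem_radical (hq0 : q ≠ 0) (i : ι) {x : List ι →₀ ℂ} (hx : x ∈ radical A d q l) :
    opE i x ∈ radical A d q l := by
  intro w
  induction w using List.reverseRecOn generalizing x with
  | nil => exact opE_apply_nil i x
  | append_singleton w j ih =>
    rw [List.map_append, List.prod_append, List.map_singleton, List.prod_singleton,
      Module.End.mul_apply, opF_opE, map_sub, Finsupp.sub_apply, ih (opF_mem_radical j hx),
      zero_sub, neg_eq_zero]
    split_ifs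
    · exact (radical A d q l).smul_mem _ ((radical A d q l).sub_mem (opK_mem_radical hq0 i hx)
        (opKinv_mem_radical hq0 i hx)) w
    · rw [map_zero, Finsupp.zero_apply]

theorem opGen_mem_radical (hq0 : q ≠ 0) (g : Gen ι) :
    radical A d q l ≤ (radical A d q l).comap (opGen A d q l g) := by
  intro x hx
  cases g with
  | E i => exact opE_mem_radical hq0 i hx
  | F i => exact opF_mem_radical i hx
  | K i => exact opK_mem_radical hq0 i hx
  | Kinv i => exact opKinv_mem_radical hq0 i hx

/-- The Serre expression commutes with every word of lowering operators, so it can be applied last;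
its image has no component at the empty word. -/
theorem serre_opE_mem_radical (hA : IsFiniteCartanDatum A d) (hq0 : q ≠ 0)
    (hq : ∀ n : ℕ, 0 < n → q ^ n ≠ 1) {i j : ι} (hij : i ≠ j) (x : List ι →₀ ℂ) :
    serre (q ^ d i) (1 - A i j).toNat (opE i) (opE j) x ∈ radical A d q l := by
  intro w
  have hd (i : ι) : 0 < d i := by have := hA.d_mem i; omega
  have hcomm : Commute (w.map (opF A d q l)).prod
      (serre (q ^ d i) (1 - A i j).toNat (opE i) (opE j)) := by
    refine Commute.list_prod_left _ _ fun f hf => ?_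
    obtain ⟨a, _, rfl⟩ := List.mem_map.mp hf
    exact ((isPreRep hq0).serre_commute hq0 hq hA.diag hA.offDiag hd hA.symm hij a).symm
  rw [← Module.End.mul_apply, hcomm.eq, Module.End.mul_apply, serre_opE_apply_nil]

/-- No quotient is needed for the F-Serre relations: the expression kills the empty word and, by the
symmetry `IsPreRep.swap`, commutes with all `opE`, which build every word from the empty one. -/
theorem serre_opF_eq_zero (hA : IsFiniteCartanDatum A d) (hq0 : q ≠ 0)
    (hq : ∀ n : ℕ, 0 < n → q ^ n ≠ 1) {i j : ι} (hij : i ≠ j) :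
    serre (q ^ d i) (1 - A i j).toNat (opF A d q l i) (opF A d q l j) = 0 := by
  have hd (i : ι) : 0 < d i := by have := hA.d_mem i; omega
  refine end_ext fun u => ?_
  rw [LinearMap.zero_apply]
  induction u with
  | nil =>
    have h0 (a : ι) : opF A d q l a (Finsupp.single [] 1) = 0 := opF_single a []
    rw [serre, LinearMap.sum_apply]
    refine Finset.sum_eq_zero fun r _ => ?_
    rcases r with _ | r
    · rw [pow_zero, pow_zero, mul_one, LinearMap.smul_apply, Module.End.mul_apply, h0, map_zero,
        smul_zero]
    · rw [pow_succ (opF A d q l i), LinearMap.smul_apply, ← mul_assoc, Module.End.mul_apply, h0, map_zero,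
        smul_zero]
  | cons a u ih =>
    have hcomm := ((isPreRep (A := A) (d := d) (l := l) hq0).swap hq0).serre_commute hq0 hq
      hA.diag hA.offDiag hd hA.symm hij a
    rw [← opE_single, ← Module.End.mul_apply, hcomm.eq, Module.End.mul_apply, ih, map_zero]

variable (A d q l) in
/-- The action of the free algebra on the space of words. -/
def freeAction : FreeAlgebra ℂ (Gen ι) →ₐ[ℂ] Module.End ℂ (List ι →₀ ℂ) :=
  FreeAlgebra.lift ℂ (opGen A d q l)

theorem freeAction_gen (g : Gen ι) : freeAction A d q l (gen g) = opGen A d q l g :=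
  FreeAlgebra.lift_ι_apply _ _

theorem freeAction_serre (c : ℂ) (m : ℕ) (x y : FreeAlgebra ℂ (Gen ι)) :
    freeAction A d q l (serre c m x y) =
      serre c m (freeAction A d q l x) (freeAction A d q l y) := by
  simp [serre]

theorem freeAction_rel (hA : IsFiniteCartanDatum A d) (hq0 : q ≠ 0)
    (hq : ∀ n : ℕ, 0 < n → q ^ n ≠ 1) {a b : FreeAlgebra ℂ (Gen ι)} (h : Rel A d q a b)
    (x : List ι →₀ ℂ) : freeAction A d q l a x - freeAction A d q l b x ∈ radical A d q l := by
  have hp := isPreRep (A := A) (d := d) (l := l) hq0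
  cases h with
  | K_Kinv i =>
    have := hp.k_k' i
    simp [freeAction_gen, opGen, this]
  | Kinv_K i =>
    have := hp.k'_k i
    simp [freeAction_gen, opGen, this]
  | K_K i j =>
    rw [map_mul, map_mul, freeAction_gen, freeAction_gen, opGen, opGen, hp.k_k, sub_self]
    exact zero_mem _
  | K_E i j =>
    rw [map_mul, map_mul, map_smul, freeAction_gen, freeAction_gen, freeAction_gen, opGen, opGen,
      opGen, hp.k_e, smul_mul_assoc, mul_assoc, hp.k_k', mul_one, sub_self]
    exact zero_mem _
  | K_F i j =>
    rw [map_mul, map_mul, map_smul, freeAction_gen, freeAction_gen, freeAction_gen, opGen, opGen,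
      opGen, hp.k_f, smul_mul_assoc, mul_assoc, hp.k_k', mul_one, sub_self]
    exact zero_mem _
  | E_F i j =>
    rw [map_sub, map_mul, map_mul, freeAction_gen, freeAction_gen, opGen, opGen, hp.e_f,
      apply_ite (freeAction A d q l), map_smul, map_sub, map_zero, freeAction_gen, freeAction_gen,
      opGen, opGen, sub_self]
    exact zero_mem _
  | serre_E i j h =>
    rw [freeAction_serre, map_zero, LinearMap.zero_apply, sub_zero, freeAction_gen, freeAction_gen]
    exact serre_opE_mem_radical hA hq0 hq h x
  | serre_F i j h =>
    rw [freeAction_serre, map_zero, LinearMap.zero_apply, sub_zero, freeAction_gen, freeAction_gen, opGen,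
      opGen, serre_opF_eq_zero hA hq0 hq h, LinearMap.zero_apply]
    exact zero_mem _

end Verma

open Verma in
/-- Lowest weight modules of every integral lowest weight exist. -/
theorem exists_lowestWeightModule {ι : Type*} [Fintype ι] [DecidableEq ι] {A : Matrix ι ι ℤ}
    {d : ι → ℕ} {q : ℂ} (hA : IsFiniteCartanDatum A d) (hq0 : q ≠ 0)
    (hq : ∀ n : ℕ, 0 < n → q ^ n ≠ 1) (l : ι → ℤ) :
    ∃ (N : Submodule ℂ (List ι →₀ ℂ))
      (ρ : U A d q →ₐ[ℂ] Module.End ℂ ((List ι →₀ ℂ) ⧸ N)) (v : (List ι →₀ ℂ) ⧸ N),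
      v ≠ 0 ∧ (∀ i, ρ (F A d q i) v = 0) ∧ ∀ i, ρ (K A d q i) v = q ^ l i • v := by
  let N := radical A d q l
  let ψ : FreeAlgebra ℂ (Gen ι) →ₐ[ℂ] Module.End ℂ ((List ι →₀ ℂ) ⧸ N) :=
    FreeAlgebra.lift ℂ fun g => N.mapQ N (opGen A d q l g) (opGen_mem_radical hq0 g)
  have hψ (a : FreeAlgebra ℂ (Gen ι)) :
      ∀ x, ψ a (N.mkQ x) = N.mkQ (freeAction A d q l a x) := by
    induction a with
    | grade0 r => intro x; rw [AlgHom.commutes, AlgHom.commutes]; simp [Module.algebraMap_end_apply]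
    | grade1 g =>
      intro x
      rw [FreeAlgebra.lift_ι_apply, freeAction, FreeAlgebra.lift_ι_apply]
      exact Submodule.mapQ_apply _ _ _ _
    | mul a b ha hb =>
      intro x
      rw [map_mul, map_mul, Module.End.mul_apply, Module.End.mul_apply, hb, ha]
    | add a b ha hb =>
      intro x
      rw [map_add, map_add, LinearMap.add_apply, LinearMap.add_apply, ha, hb, map_add]
  have hrel {a b : FreeAlgebra ℂ (Gen ι)} (h : Rel A d q a b) : ψ a = ψ b := by
    refine LinearMap.ext fun x => ?_
    obtain ⟨x, rfl⟩ := N.mkQ_surjective x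
    rw [hψ, hψ, ← sub_eq_zero, ← map_sub, Submodule.mkQ_apply, Submodule.Quotient.mk_eq_zero]
    exact freeAction_rel hA hq0 hq h x
  let ρ : U A d q →ₐ[ℂ] Module.End ℂ ((List ι →₀ ℂ) ⧸ N) :=
    RingQuot.liftAlgHom ℂ ⟨ψ, fun _ _ h => hrel h⟩
  have hρ (g : Gen ι) (x : List ι →₀ ℂ) : ρ (mk A d q g) (N.mkQ x) =
      N.mkQ (opGen A d q l g x) := by
    have : ρ (mk A d q g) = ψ (gen g) := RingQuot.liftAlgHom_mkAlgHom_apply _ _ _ _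
    rw [this, hψ, freeAction_gen]
  refine ⟨N, ρ, N.mkQ (Finsupp.single [] 1), ?_, fun i => ?_, fun i => ?_⟩
  -- The empty word of lowering operators shows that the lowest weight vector is not in the radical.
  · intro h
    rw [Submodule.mkQ_apply, Submodule.Quotient.mk_eq_zero] at h
    have := h []
    simp at this
  · rw [F, hρ, opGen, opF_single, lower, map_zero]
  · rw [K, hρ, opGen, opK_single, map_smul, eigenvalue, wt_nil, rootPairing_zero, add_zero]

/-! ### Straightening: U is spanned by products E_u k F_v. -/

section Spanning

variable {ι : Type*} [DecidableEq ι] (A : Matrix ι ι ℤ) (d : ι → ℕ) (q : ℂ)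

theorem isPreRep_U : IsPreRep A d q (E A d q) (F A d q) (K A d q) (Kinv A d q) where
  k_k' := K_mul_Kinv A d q
  k'_k := Kinv_mul_K A d q
  k_k i j := by
    have h := RingQuot.mkAlgHom_rel ℂ (Rel.K_K (A := A) (d := d) (q := q) i j)
    rw [map_mul, map_mul] at h
    exact h
  k_e i j := by
    have h := RingQuot.mkAlgHom_rel ℂ (Rel.K_E (A := A) (d := d) (q := q) i j)
    rw [map_mul, map_mul, map_smul] at h
    have h : K A d q i * E A d q j * Kinv A d q i = (q ^ d i) ^ A i j • E A d q j := h
    rw [← smul_mul_assoc, ← h, mul_assoc _ (Kinv A d q i), Kinv_mul_K, mul_one]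
  k_f i j := by
    have h := RingQuot.mkAlgHom_rel ℂ (Rel.K_F (A := A) (d := d) (q := q) i j)
    rw [map_mul, map_mul, map_smul] at h
    have h : K A d q i * F A d q j * Kinv A d q i = (q ^ d i) ^ (-A i j) • F A d q j := h
    rw [← smul_mul_assoc, ← h, mul_assoc _ (Kinv A d q i), Kinv_mul_K, mul_one]
  e_f i j := by
    have h := RingQuot.mkAlgHom_rel ℂ (Rel.E_F (A := A) (d := d) (q := q) i j)
    rw [map_sub, map_mul, map_mul, apply_ite (RingQuot.mkAlgHom ℂ (Rel A d q)), map_smul, map_sub,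
      map_zero] at h
    exact h

theorem mkAlgHom_serre (c : ℂ) (m : ℕ) (x y : FreeAlgebra ℂ (Gen ι)) :
    (RingQuot.mkAlgHom ℂ (Rel A d q) (serre c m x y) : U A d q) =
      serre (R := U A d q) c m (RingQuot.mkAlgHom ℂ (Rel A d q) x : U A d q)
        (RingQuot.mkAlgHom ℂ (Rel A d q) y : U A d q) := by
  simp only [serre, map_sum, map_smul, map_mul, map_pow]
  rfl

variable {A d q}

theorem commute_of_serre {R : Type*} [Ring R] [Algebra ℂ R] {c : ℂ} (hc0 : c ≠ 0)
    (hc : ∀ n : ℕ, 0 < n → c ^ n ≠ 1) {x y : R} (h : serre c 1 x y = 0) : Commute x y := by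
  rw [serre, Finset.sum_range_succ, Finset.sum_range_one, qBinomial_zero_right hc0 hc,
    qBinomial_self hc0 hc] at h
  have h1 : x * y = y * x := by simpa [← sub_eq_add_neg, sub_eq_zero] using h
  exact h1

theorem E_commute_E (hq0 : q ≠ 0) (hq : ∀ n : ℕ, 0 < n → q ^ n ≠ 1) (hd : ∀ i, 0 < d i) {i j : ι}
    (hij : i ≠ j) (h0 : A i j = 0) : Commute (E A d q i) (E A d q j) := by
  have h := RingQuot.mkAlgHom_rel ℂ (Rel.serre_E (A := A) (d := d) (q := q) i j hij)
  rw [map_zero, h0] at h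
  exact commute_of_serre (pow_ne_zero (d i) hq0)
    (fun n hn => by rw [← pow_mul]; exact hq _ (Nat.mul_pos (hd i) hn))
    ((mkAlgHom_serre A d q _ _ _ _).symm.trans h)

theorem F_commute_F (hq0 : q ≠ 0) (hq : ∀ n : ℕ, 0 < n → q ^ n ≠ 1) (hd : ∀ i, 0 < d i) {i j : ι}
    (hij : i ≠ j) (h0 : A i j = 0) : Commute (F A d q i) (F A d q j) := by
  have h := RingQuot.mkAlgHom_rel ℂ (Rel.serre_F (A := A) (d := d) (q := q) i j hij)
  rw [map_zero, h0] at h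
  exact commute_of_serre (pow_ne_zero (d i) hq0)
    (fun n hn => by rw [← pow_mul]; exact hq _ (Nat.mul_pos (hd i) hn))
    ((mkAlgHom_serre A d q _ _ _ _).symm.trans h)

theorem E_commute_F {i j : ι} (hij : i ≠ j) : Commute (E A d q i) (F A d q j) := by
  have := (isPreRep_U A d q).e_f i j
  rwa [if_neg hij, sub_eq_zero] at this

theorem U_induction {p : U A d q → Prop} (halg : ∀ r : ℂ, p (algebraMap ℂ _ r))
    (hE : ∀ i, p (E A d q i)) (hF : ∀ i, p (F A d q i)) (hK : ∀ i, p (K A d q i))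
    (hKinv : ∀ i, p (Kinv A d q i)) (hadd : ∀ x y, p x → p y → p (x + y))
    (hmul : ∀ x y, p x → p y → p (x * y)) (x : U A d q) : p x := by
  obtain ⟨a, rfl⟩ := RingQuot.mkAlgHom_surjective ℂ (Rel A d q) x
  induction a with
  | grade0 r => exact (AlgHom.commutes (RingQuot.mkAlgHom ℂ (Rel A d q)) r).symm ▸ halg r
  | grade1 g =>
    cases g with
    | E i => exact hE i
    | F i => exact hF i
    | K i => exact hK i
    | Kinv i => exact hKinv i
  | mul a b ha hb => rw [map_mul]; exact hmul _ _ ha hb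
  | add a b ha hb => rw [map_add]; exact hadd _ _ ha hb

section Cartan

theorem K_mem_Ucartan (i : ι) : K A d q i ∈ Ucartan A d q :=
  Algebra.subset_adjoin (Or.inl ⟨i, rfl⟩)

theorem Kinv_mem_Ucartan (i : ι) : Kinv A d q i ∈ Ucartan A d q :=
  Algebra.subset_adjoin (Or.inr ⟨i, rfl⟩)

variable (A d q) in
/-- The coefficient `(K_i - K_i⁻¹) / (q_i - q_i⁻¹)` of the commutator of `E_i` and `F_i`. -/
def cartanH (i : ι) : U A d q := (q ^ d i - (q ^ d i)⁻¹)⁻¹ • (K A d q i - Kinv A d q i)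

theorem cartanH_mem (i : ι) : cartanH A d q i ∈ Ucartan A d q :=
  Subalgebra.smul_mem _ (sub_mem (K_mem_Ucartan i) (Kinv_mem_Ucartan i)) _

theorem F_mul_E (i j : ι) : F A d q i * E A d q j =
    E A d q j * F A d q i - if j = i then cartanH A d q i else 0 := by
  have h := (isPreRep_U A d q).e_f j i
  by_cases hij : j = i
  · subst hij
    rw [if_pos rfl] at h ⊢
    rw [cartanH, ← h]; abel
  · rw [if_neg hij] at h ⊢
    rw [sub_zero, ← sub_eq_zero.mp h]

theorem exists_mul_eq_of_mem_Ucartan {x : U A d q}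
    (h1 : ∀ i, ∃ a : ℂ, K A d q i * x = a • (x * K A d q i))
    (h2 : ∀ i, ∃ a : ℂ, Kinv A d q i * x = a • (x * Kinv A d q i)) {k : U A d q}
    (hk : k ∈ Ucartan A d q) : ∃ k' ∈ Ucartan A d q, k * x = x * k' := by
  induction hk using Algebra.adjoin_induction with
  | mem y hy =>
    rcases hy with ⟨i, rfl⟩ | ⟨i, rfl⟩
    · obtain ⟨a, ha⟩ := h1 i
      exact ⟨a • K A d q i, Subalgebra.smul_mem _ (K_mem_Ucartan i) a, by
        rw [ha, mul_smul_comm]⟩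
    · obtain ⟨a, ha⟩ := h2 i
      exact ⟨a • Kinv A d q i, Subalgebra.smul_mem _ (Kinv_mem_Ucartan i) a, by
        rw [ha, mul_smul_comm]⟩
  | algebraMap r => exact ⟨algebraMap ℂ _ r, Subalgebra.algebraMap_mem _ r, Algebra.commutes r x⟩
  | add y z _ _ hy hz =>
    obtain ⟨y', hy', hy⟩ := hy
    obtain ⟨z', hz', hz⟩ := hz
    exact ⟨y' + z', add_mem hy' hz', by rw [add_mul, hy, hz, mul_add]⟩
  | mul y z _ _ hy hz =>
    obtain ⟨y', hy', hy⟩ := hy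
    obtain ⟨z', hz', hz⟩ := hz
    exact ⟨y' * z', mul_mem hy' hz', by rw [mul_assoc, hz, ← mul_assoc, hy, mul_assoc]⟩

theorem exists_mul_eq_of_mem_Ucartan' {x : U A d q}
    (h1 : ∀ i, ∃ a : ℂ, x * K A d q i = a • (K A d q i * x))
    (h2 : ∀ i, ∃ a : ℂ, x * Kinv A d q i = a • (Kinv A d q i * x)) {k : U A d q}
    (hk : k ∈ Ucartan A d q) : ∃ k' ∈ Ucartan A d q, x * k = k' * x := by
  induction hk using Algebra.adjoin_induction with
  | mem y hy =>
    rcases hy with ⟨i, rfl⟩ | ⟨i, rfl⟩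
    · obtain ⟨a, ha⟩ := h1 i
      exact ⟨a • K A d q i, Subalgebra.smul_mem _ (K_mem_Ucartan i) a, by
        rw [ha, smul_mul_assoc]⟩
    · obtain ⟨a, ha⟩ := h2 i
      exact ⟨a • Kinv A d q i, Subalgebra.smul_mem _ (Kinv_mem_Ucartan i) a, by
        rw [ha, smul_mul_assoc]⟩
  | algebraMap r =>
    exact ⟨algebraMap ℂ _ r, Subalgebra.algebraMap_mem _ r, (Algebra.commutes r x).symm⟩
  | add y z _ _ hy hz =>
    obtain ⟨y', hy', hy⟩ := hy
    obtain ⟨z', hz', hz⟩ := hz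
    exact ⟨y' + z', add_mem hy' hz', by rw [mul_add, hy, hz, add_mul]⟩
  | mul y z _ _ hy hz =>
    obtain ⟨y', hy', hy⟩ := hy
    obtain ⟨z', hz', hz⟩ := hz
    exact ⟨y' * z', mul_mem hy' hz', by rw [← mul_assoc, hy, mul_assoc, hz, mul_assoc]⟩

theorem mul_eq_smul_symm {x y : U A d q} {a : ℂ} (ha : a ≠ 0) (h : x * y = a • (y * x)) :
    ∃ b : ℂ, y * x = b • (x * y) :=
  ⟨a⁻¹, by rw [h, smul_smul, inv_mul_cancel₀ ha, one_smul]⟩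

theorem Ucartan_mul_E (hq0 : q ≠ 0) (i : ι) {k : U A d q} (hk : k ∈ Ucartan A d q) :
    ∃ k' ∈ Ucartan A d q, k * E A d q i = E A d q i * k' :=
  exists_mul_eq_of_mem_Ucartan (fun _ => ⟨_, (isPreRep_U A d q).k_e _ _⟩)
    (fun _ => ⟨_, (isPreRep_U A d q).k'_e hq0 _ _⟩) hk

theorem Ucartan_mul_F (hq0 : q ≠ 0) (i : ι) {k : U A d q} (hk : k ∈ Ucartan A d q) :
    ∃ k' ∈ Ucartan A d q, k * F A d q i = F A d q i * k' :=
  exists_mul_eq_of_mem_Ucartan (fun _ => ⟨_, (isPreRep_U A d q).k_f _ _⟩)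
    (fun _ => ⟨_, (isPreRep_U A d q).k'_f hq0 _ _⟩) hk

theorem F_mul_Ucartan (hq0 : q ≠ 0) (i : ι) {k : U A d q} (hk : k ∈ Ucartan A d q) :
    ∃ k' ∈ Ucartan A d q, F A d q i * k = k' * F A d q i :=
  exists_mul_eq_of_mem_Ucartan'
    (fun _ => mul_eq_smul_symm (zpow_ne_zero _ (pow_ne_zero _ hq0)) ((isPreRep_U A d q).k_f _ _))
    (fun _ => mul_eq_smul_symm (zpow_ne_zero _ (pow_ne_zero _ hq0))
      ((isPreRep_U A d q).k'_f hq0 _ _)) hk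

end Cartan

variable (A d q) in
/-- The product of the `E_i` along a word. -/
def Eword (u : List ι) : U A d q := (u.map (E A d q)).prod

variable (A d q) in
/-- The product of the `F_i` along a word. -/
def Fword (u : List ι) : U A d q := (u.map (F A d q)).prod

theorem Eword_nil : Eword A d q [] = 1 := rfl

theorem Fword_nil : Fword A d q [] = 1 := rfl

theorem Eword_cons (i : ι) (u : List ι) : Eword A d q (i :: u) = E A d q i * Eword A d q u := by
  simp [Eword]

theorem Fword_cons (i : ι) (u : List ι) : Fword A d q (i :: u) = F A d q i * Fword A d q u := by
  simp [Fword]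

theorem Eword_append (u v : List ι) :
    Eword A d q (u ++ v) = Eword A d q u * Eword A d q v := by simp [Eword]

theorem Fword_append (u v : List ι) :
    Fword A d q (u ++ v) = Fword A d q u * Fword A d q v := by simp [Fword]

theorem Ucartan_mul_Eword (hq0 : q ≠ 0) (u : List ι) {k : U A d q} (hk : k ∈ Ucartan A d q) :
    ∃ k' ∈ Ucartan A d q, k * Eword A d q u = Eword A d q u * k' := by
  induction u generalizing k with
  | nil => exact ⟨k, hk, by rw [Eword_nil, mul_one, one_mul]⟩
  | cons i u ih =>
    obtain ⟨k', hk', h'⟩ := Ucartan_mul_E hq0 i hk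
    obtain ⟨k'', hk'', h''⟩ := ih hk'
    exact ⟨k'', hk'', by rw [Eword_cons, ← mul_assoc, h', mul_assoc, h'', mul_assoc]⟩

theorem Ucartan_mul_Fword (hq0 : q ≠ 0) (u : List ι) {k : U A d q} (hk : k ∈ Ucartan A d q) :
    ∃ k' ∈ Ucartan A d q, k * Fword A d q u = Fword A d q u * k' := by
  induction u generalizing k with
  | nil => exact ⟨k, hk, by rw [Fword_nil, mul_one, one_mul]⟩
  | cons i u ih =>
    obtain ⟨k', hk', h'⟩ := Ucartan_mul_F hq0 i hk
    obtain ⟨k'', hk'', h''⟩ := ih hk'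
    exact ⟨k'', hk'', by rw [Fword_cons, ← mul_assoc, h', mul_assoc, h'', mul_assoc]⟩

theorem Fword_mul_Ucartan (hq0 : q ≠ 0) (u : List ι) {k : U A d q} (hk : k ∈ Ucartan A d q) :
    ∃ k' ∈ Ucartan A d q, Fword A d q u * k = k' * Fword A d q u := by
  induction u with
  | nil => exact ⟨k, hk, by rw [Fword_nil, mul_one, one_mul]⟩
  | cons i u ih =>
    obtain ⟨k', hk', h'⟩ := ih
    obtain ⟨k'', hk'', h''⟩ := F_mul_Ucartan hq0 i hk'
    exact ⟨k'', hk'', by rw [Fword_cons, mul_assoc, h', ← mul_assoc, h'', mul_assoc]⟩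

variable (A d q) in
/-- The span of the products `E_u k F_v` with `k ∈ U⁰` and `(u, v)` satisfying `p`. -/
def triangularSpan (p : List ι → List ι → Prop) : Submodule ℂ (U A d q) :=
  Submodule.span ℂ {x | ∃ u v, p u v ∧ ∃ k ∈ Ucartan A d q, x = Eword A d q u * k * Fword A d q v}

theorem mem_triangularSpan {p : List ι → List ι → Prop} {u v : List ι} (h : p u v) {k : U A d q}
    (hk : k ∈ Ucartan A d q) : Eword A d q u * k * Fword A d q v ∈ triangularSpan A d q p :=
  Submodule.subset_span ⟨u, v, h, k, hk, rfl⟩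

theorem triangularSpan_le {p : List ι → List ι → Prop} {M : Submodule ℂ (U A d q)}
    (h : ∀ u v, p u v → ∀ k ∈ Ucartan A d q, Eword A d q u * k * Fword A d q v ∈ M) :
    triangularSpan A d q p ≤ M := by
  refine Submodule.span_le.mpr ?_
  rintro _ ⟨u, v, huv, k, hk, rfl⟩
  exact h u v huv k hk

theorem triangularSpan_mono {p p' : List ι → List ι → Prop} (h : ∀ u v, p u v → p' u v) :
    triangularSpan A d q p ≤ triangularSpan A d q p' :=
  triangularSpan_le fun _ _ huv _ hk => mem_triangularSpan (h _ _ huv) hk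

theorem mul_mem_of_triangularSpan {p : List ι → List ι → Prop} {M : Submodule ℂ (U A d q)}
    {y z : U A d q}
    (h : ∀ u v, p u v → ∀ k ∈ Ucartan A d q, y * (Eword A d q u * k * Fword A d q v) * z ∈ M)
    {x : U A d q} (hx : x ∈ triangularSpan A d q p) : y * x * z ∈ M := by
  have : triangularSpan A d q p ≤
      M.comap ((LinearMap.mulRight ℂ z).comp (LinearMap.mulLeft ℂ y)) :=
    triangularSpan_le fun u v huv k hk => h u v huv k hk
  exact this hx

/-- The correction comes from the commutators with the letters i of u: each replaces one such letter
by a torus element, so it has one α_i less and no F. -/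
theorem F_mul_Eword (hq0 : q ≠ 0) (i : ι) (u : List ι) :
    ∃ x ∈ triangularSpan A d q (fun u' v' => wt u' + Pi.single i 1 = wt u ∧ v' = []),
      F A d q i * Eword A d q u = Eword A d q u * F A d q i + x := by
  induction u with
  | nil => exact ⟨0, zero_mem _, by rw [Eword_nil, mul_one, one_mul, add_zero]⟩
  | cons j u ih =>
    obtain ⟨x, hx, h⟩ := ih
    refine ⟨E A d q j * x - (if j = i then cartanH A d q i else 0) * Eword A d q u,
      sub_mem ?_ ?_, ?_⟩
    · rw [← mul_one (_ * x)]
      refine mul_mem_of_triangularSpan (fun u' v' huv k hk => ?_) hx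
      obtain ⟨h1, rfl⟩ := huv
      rw [mul_one, ← mul_assoc, ← mul_assoc, ← Eword_cons]
      refine mem_triangularSpan ⟨?_, rfl⟩ hk
      rw [wt_cons, wt_cons, add_assoc, h1]
    · split_ifs with hji
      · subst hji
        obtain ⟨k, hk, h2⟩ := Ucartan_mul_Eword hq0 u (cartanH_mem (A := A) (d := d) (q := q) j)
        rw [h2, ← mul_one (_ * k), ← Fword_nil]
        exact mem_triangularSpan ⟨by rw [wt_cons, add_comm], rfl⟩ hk
      · rw [zero_mul]; exact zero_mem _
    · rw [Eword_cons, ← mul_assoc, F_mul_E, sub_mul, mul_assoc, h, mul_add]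
      simp only [mul_assoc]
      abel

/-- Straightening `F_i` past an element of the triangular form. -/
theorem F_mul_mem (hq0 : q ≠ 0) (i : ι) {a b : ι → ℤ} {x : U A d q}
    (hx : x ∈ triangularSpan A d q (fun u v => ∃ μ, 0 ≤ μ ∧ wt u + μ = a ∧ wt v + μ = b)) :
    F A d q i * x ∈ triangularSpan A d q
      (fun u v => ∃ μ, 0 ≤ μ ∧ wt u + μ = a ∧ wt v + μ = Pi.single i 1 + b) := by
  rw [← mul_one (_ * x)]
  refine mul_mem_of_triangularSpan (fun u v huv k hk => ?_) hx
  obtain ⟨μ, hμ, rfl, rfl⟩ := huv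
  obtain ⟨y, hy, h⟩ := F_mul_Eword (A := A) (d := d) hq0 i u
  rw [mul_one, ← mul_assoc, ← mul_assoc, h, add_mul, add_mul]
  refine add_mem ?_ ?_
  · obtain ⟨k', hk', h'⟩ := F_mul_Ucartan hq0 i hk
    rw [mul_assoc _ _ k, h', mul_assoc, mul_assoc, ← Fword_cons, ← mul_assoc]
    exact mem_triangularSpan ⟨μ, hμ, rfl, by rw [wt_cons, add_assoc]⟩ hk'
  · rw [mul_assoc, ← one_mul y]
    refine mul_mem_of_triangularSpan (fun u' v' huv k' hk' => ?_) hy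
    obtain ⟨h1, rfl⟩ := huv
    rw [one_mul, Fword_nil, mul_one, ← mul_assoc, mul_assoc _ k']
    refine mem_triangularSpan ⟨Pi.single i 1 + μ, ?_, ?_, ?_⟩ (mul_mem hk' hk)
    · exact add_nonneg (Pi.single_nonneg.mpr zero_le_one) hμ
    · rw [← add_assoc, h1]
    · abel

/-- Here μ is the weight cancelled by commutators, the same on both sides. This bookkeeping
underlies all later weight bounds. -/
theorem Fword_mul_Eword_mem (hq0 : q ≠ 0) (v u : List ι) :
    Fword A d q v * Eword A d q u ∈ triangularSpan A d q
      (fun u' v' => ∃ μ, 0 ≤ μ ∧ wt u' + μ = wt u ∧ wt v' + μ = wt v) := by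
  induction v with
  | nil =>
    have := mem_triangularSpan (A := A) (d := d) (q := q)
      (p := fun u' v' => ∃ μ, 0 ≤ μ ∧ wt u' + μ = wt u ∧ wt v' + μ = wt [])
      (u := u) (v := []) ⟨0, le_rfl, add_zero _, add_zero _⟩ (one_mem _)
    rwa [mul_one, Fword_nil, mul_one, ← one_mul (Eword _ _ _ u), ← Fword_nil] at this
  | cons i v ih =>
    rw [Fword_cons, mul_assoc, wt_cons]
    exact F_mul_mem hq0 i ih

theorem triangularSpan_eq_top (hq0 : q ≠ 0) :
    triangularSpan A d q (fun _ _ => True) = ⊤ := by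
  have key : ∀ x y : U A d q, y ∈ triangularSpan A d q (fun _ _ => True) →
      x * y ∈ triangularSpan A d q (fun _ _ => True) := by
    intro x
    induction x using U_induction with
    | halg r =>
      intro y hy
      rw [← Algebra.smul_def]
      exact Submodule.smul_mem _ r hy
    | hE i =>
      intro y hy
      rw [← mul_one (_ * y)]
      refine mul_mem_of_triangularSpan (fun u v _ k hk => ?_) hy
      rw [mul_one, ← mul_assoc, ← mul_assoc, ← Eword_cons]
      exact mem_triangularSpan trivial hk
    | hF i =>
      intro y hy
      rw [← mul_one (_ * y)]
      refine mul_mem_of_triangularSpan (fun u v _ k hk => ?_) hy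
      rw [mul_one]
      exact triangularSpan_mono (fun _ _ _ => trivial)
        (F_mul_mem hq0 i (mem_triangularSpan ⟨0, le_rfl, rfl, rfl⟩ hk))
    | hK i =>
      intro y hy
      rw [← mul_one (_ * y)]
      refine mul_mem_of_triangularSpan (fun u v _ k hk => ?_) hy
      obtain ⟨k', hk', h⟩ := Ucartan_mul_Eword hq0 u (K_mem_Ucartan (A := A) (d := d) (q := q) i)
      rw [mul_one, ← mul_assoc, ← mul_assoc, h, mul_assoc _ k']
      exact mem_triangularSpan trivial (mul_mem hk' hk)
    | hKinv i =>
      intro y hy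
      rw [← mul_one (_ * y)]
      refine mul_mem_of_triangularSpan (fun u v _ k hk => ?_) hy
      obtain ⟨k', hk', h⟩ :=
        Ucartan_mul_Eword hq0 u (Kinv_mem_Ucartan (A := A) (d := d) (q := q) i)
      rw [mul_one, ← mul_assoc, ← mul_assoc, h, mul_assoc _ k']
      exact mem_triangularSpan trivial (mul_mem hk' hk)
    | hadd x x' hx hx' =>
      intro y hy
      rw [add_mul]
      exact add_mem (hx y hy) (hx' y hy)
    | hmul x x' hx hx' =>
      intro y hy
      rw [mul_assoc]
      exact hx _ (hx' y hy)
  refine Submodule.eq_top_iff'.mpr fun x => ?_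
  have := mem_triangularSpan (A := A) (d := d) (q := q) (p := fun _ _ => True)
    (u := []) (v := []) trivial (one_mem _)
  rw [Eword_nil, Fword_nil, mul_one, mul_one] at this
  simpa using key x 1 this

/-- The straightened product of two elements of triangular form. -/
theorem triangularSpan_mul_mem (hq0 : q ≠ 0) {u v u' v' : List ι} {k k' : U A d q}
    (hk : k ∈ Ucartan A d q) (hk' : k' ∈ Ucartan A d q) :
    (Eword A d q u * k * Fword A d q v) * (Eword A d q u' * k' * Fword A d q v') ∈
      triangularSpan A d q (fun a b => ∃ α β μ, 0 ≤ μ ∧ 0 ≤ α ∧ 0 ≤ β ∧ α + μ = wt u' ∧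
        β + μ = wt v ∧ wt a = wt u + α ∧ wt b = β + wt v') := by
  rw [show (Eword A d q u * k * Fword A d q v) * (Eword A d q u' * k' * Fword A d q v') =
    (Eword A d q u * k) * (Fword A d q v * Eword A d q u') * (k' * Fword A d q v') by
      simp only [mul_assoc]]
  refine mul_mem_of_triangularSpan (fun a b hab m hm => ?_) (Fword_mul_Eword_mem hq0 v u')
  obtain ⟨μ, hμ, h1, h2⟩ := hab
  obtain ⟨k1, hk1, e1⟩ := Ucartan_mul_Eword hq0 a hk
  obtain ⟨k2, hk2, e2⟩ := Fword_mul_Ucartan hq0 b hk'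
  rw [show Eword A d q u * k * (Eword A d q a * m * Fword A d q b) * (k' * Fword A d q v') =
    Eword A d q u * (k * Eword A d q a) * m * (Fword A d q b * k') * Fword A d q v' by
      simp only [mul_assoc], e1, e2,
    show Eword A d q u * (Eword A d q a * k1) * m * (k2 * Fword A d q b) * Fword A d q v' =
      Eword A d q u * Eword A d q a * (k1 * m * k2) * (Fword A d q b * Fword A d q v') by
      simp only [mul_assoc], ← Eword_append, ← Fword_append]
  exact mem_triangularSpan ⟨wt a, wt b, μ, hμ, wt_nonneg a, wt_nonneg b, h1, h2, wt_append _ _,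
    wt_append _ _⟩ (mul_mem (mul_mem hk1 hm) hk2)

theorem mul_mem_of_triangularSpan₂ (hq0 : q ≠ 0) {p p' r : List ι → List ι → Prop}
    (hp : ∀ u v, p u v → wt u = wt v) (hp' : ∀ u v, p' u v → wt u = wt v)
    (h : ∀ u v u' v' a b, p u v → p' u' v' → wt a = wt b → wt u ≤ wt a → wt u' ≤ wt a →
      wt a ≤ wt u + wt u' → r a b) {x y : U A d q} (hx : x ∈ triangularSpan A d q p)
    (hy : y ∈ triangularSpan A d q p') : x * y ∈ triangularSpan A d q r := by
  rw [← one_mul x]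
  refine mul_mem_of_triangularSpan (fun u v huv k hk => ?_) hx
  rw [one_mul, ← mul_one (_ * y)]
  refine mul_mem_of_triangularSpan (fun u' v' huv' k' hk' => ?_) hy
  rw [mul_one]
  refine triangularSpan_mono ?_ (triangularSpan_mul_mem hq0 hk hk')
  rintro a b ⟨α, β, μ, hμ, hα, hβ, h1, h2, h3, h4⟩
  have e1 := hp u v huv
  have e2 := hp' u' v' huv'
  have hab : wt a = wt b := by rw [h3, h4, ← e2, ← h1, e1, ← h2]; abel
  refine h u v u' v' a b huv huv' hab ?_ ?_ ?_
  · rw [h3]; exact le_add_of_nonneg_right hα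
  · rw [hab, h4, e2]; exact le_add_of_nonneg_left hβ
  · rw [h3, ← h1]; exact add_le_add_right (le_add_of_nonneg_right hμ) _

theorem Fword_apply_eq_zero {M : Type*} [AddCommGroup M] [Module ℂ M]
    {ρ : U A d q →ₐ[ℂ] Module.End ℂ M} {v : M} (hF : ∀ i, ρ (F A d q i) v = 0) {u : List ι} (hu : u ≠ []) :
    ρ (Fword A d q u) v = 0 := by
  induction u with
  | nil => exact absurd rfl hu
  | cons i u ih =>
    rw [Fword_cons, map_mul, Module.End.mul_apply]
    by_cases h : u = []
    · rw [h, Fword_nil, map_one, Module.End.one_apply, hF]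
    · rw [ih h, map_zero]

theorem Eword_perm {S : Set ι} (hcomm : ∀ i ∈ S, ∀ j ∈ S, Commute (E A d q i) (E A d q j)) {u w : List ι}
    (h : u.Perm w) (hu : ∀ i ∈ u, i ∈ S) : Eword A d q u = Eword A d q w := by
  induction h with
  | nil => rfl
  | cons i _ ih => rw [Eword_cons, Eword_cons, ih fun j hj => hu j (List.mem_cons_of_mem _ hj)]
  | swap i j u =>
    rw [Eword_cons, Eword_cons, Eword_cons, Eword_cons, ← mul_assoc, ← mul_assoc,
      (hcomm j (hu j (by simp)) i (hu i (by simp))).eq]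
  | trans h1 _ ih1 ih2 => rw [ih1 hu, ih2 fun i hi => hu i (h1.mem_iff.mpr hi)]

theorem Fword_perm {S : Set ι} (hcomm : ∀ i ∈ S, ∀ j ∈ S, Commute (F A d q i) (F A d q j)) {u w : List ι}
    (h : u.Perm w) (hu : ∀ i ∈ u, i ∈ S) : Fword A d q u = Fword A d q w := by
  induction h with
  | nil => rfl
  | cons i _ ih => rw [Fword_cons, Fword_cons, ih fun j hj => hu j (List.mem_cons_of_mem _ hj)]
  | swap i j u =>
    rw [Fword_cons, Fword_cons, Fword_cons, Fword_cons, ← mul_assoc, ← mul_assoc,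
      (hcomm j (hu j (by simp)) i (hu i (by simp))).eq]
  | trans h1 _ ih1 ih2 => rw [ih1 hu, ih2 fun i hi => hu i (h1.mem_iff.mpr hi)]

theorem perm_of_wt_eq {u w : List ι} (h : wt u = wt w) : u.Perm w :=
  List.perm_iff_count.mpr fun i => by
    have := congrFun h i
    simp only [wt] at this
    exact_mod_cast this

/-- If straightening left no F at all, the whole weight of w would have been cancelled against u,
forcing wt w ≤ wt u. So every term ends in some F, which kills v. -/
theorem Fword_Eword_apply_eq_zero {M : Type*} [AddCommGroup M] [Module ℂ M]
    {ρ : U A d q →ₐ[ℂ] Module.End ℂ M} {v : M} (hq0 : q ≠ 0) (hF : ∀ i, ρ (F A d q i) v = 0) {w u : List ι}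
    (h : ¬ wt w ≤ wt u) : ρ (Fword A d q w) (ρ (Eword A d q u) v) = 0 := by
  rw [← Module.End.mul_apply, ← map_mul]
  have key : triangularSpan A d q
      (fun u' v' => ∃ μ, 0 ≤ μ ∧ wt u' + μ = wt u ∧ wt v' + μ = wt w) ≤
        LinearMap.ker ((LinearMap.applyₗ v).comp ρ.toLinearMap) := by
    refine triangularSpan_le fun u' v' huv k hk => ?_
    obtain ⟨μ, hμ, h1, h2⟩ := huv
    have hv' : v' ≠ [] := by
      rintro rfl
      rw [wt_nil, zero_add] at h2
      exact h (by rw [← h1, ← h2]; exact le_add_of_nonneg_left (wt_nonneg u'))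
    change ρ _ v = 0
    rw [map_mul, Module.End.mul_apply, Fword_apply_eq_zero hF hv', map_zero]
  exact key (Fword_mul_Eword_mem hq0 w u)

theorem triangularSpan_apply_eq_zero {M : Type*} [AddCommGroup M] [Module ℂ M]
    {ρ : U A d q →ₐ[ℂ] Module.End ℂ M} {v : M} (hq0 : q ≠ 0) (hF : ∀ i, ρ (F A d q i) v = 0) {u : List ι}
    {p : List ι → List ι → Prop} (hp : ∀ u' v', p u' v' → ¬ wt v' ≤ wt u) {x : U A d q}
    (hx : x ∈ triangularSpan A d q p) : ρ x (ρ (Eword A d q u) v) = 0 := by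
  have key : triangularSpan A d q p ≤
      LinearMap.ker ((LinearMap.applyₗ (ρ (Eword A d q u) v)).comp ρ.toLinearMap) := by
    refine triangularSpan_le fun u' v' huv k hk => ?_
    change ρ _ _ = 0
    rw [map_mul, Module.End.mul_apply, Fword_Eword_apply_eq_zero hq0 hF (hp u' v' huv), map_zero]
  exact key hx

end Spanning

/-! ### Weight spaces, and the components U_{0,σ} as spans of words. -/

section WeightDecomposition

variable {ι : Type*} [Fintype ι] [DecidableEq ι] {A : Matrix ι ι ℤ} {d : ι → ℕ} {q : ℂ}

theorem mul_mem_weightSpace (hq0 : q ≠ 0) {γ δ : ι → ℤ} {x y : U A d q}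
    (hx : x ∈ weightSpace A d q γ) (hy : y ∈ weightSpace A d q δ) :
    x * y ∈ weightSpace A d q (γ + δ) := by
  intro i
  have : K A d q i * (x * y) * Kinv A d q i =
      (K A d q i * x * Kinv A d q i) * (K A d q i * y * Kinv A d q i) := by
    calc _ = K A d q i * x * (Kinv A d q i * K A d q i) * y * Kinv A d q i := by
          rw [Kinv_mul_K]; simp only [mul_assoc, one_mul]
      _ = _ := by simp only [mul_assoc]
  rw [this, hx i, hy i, rootPairing_add, zpow_add₀ hq0, smul_mul_smul_comm]

theorem Ucartan_le_Uzero : Ucartan A d q ≤ Uzero A d q := by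
  refine Algebra.adjoin_le ?_
  have h := isPreRep_U A d q
  rintro _ (⟨j, rfl⟩ | ⟨j, rfl⟩) i
  · rw [h.k_k i j, mul_assoc, K_mul_Kinv, mul_one, rootPairing_zero, zpow_zero, one_smul]
  · rw [mul_assoc, h.k'_k' j i, ← mul_assoc, K_mul_Kinv, one_mul, rootPairing_zero, zpow_zero,
      one_smul]

theorem E_mem_weightSpace (i : ι) : E A d q i ∈ weightSpace A d q (Pi.single i 1) := by
  intro j
  rw [(isPreRep_U A d q).k_e, smul_mul_assoc, mul_assoc, K_mul_Kinv, mul_one, rootPairing_single,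
    zpow_mul, zpow_natCast]

theorem F_mem_weightSpace (i : ι) : F A d q i ∈ weightSpace A d q (-Pi.single i 1) := by
  intro j
  rw [(isPreRep_U A d q).k_f, smul_mul_assoc, mul_assoc, K_mul_Kinv, mul_one, rootPairing_neg,
    rootPairing_single, ← mul_neg, zpow_mul, zpow_natCast]

theorem Eword_mem_weightSpace (hq0 : q ≠ 0) (u : List ι) :
    Eword A d q u ∈ weightSpace A d q (wt u) := by
  induction u with
  | nil => exact one_mem (Uzero A d q)
  | cons i u ih =>
    rw [Eword_cons, wt_cons]
    exact mul_mem_weightSpace hq0 (E_mem_weightSpace i) ih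

theorem Fword_mem_weightSpace (hq0 : q ≠ 0) (u : List ι) :
    Fword A d q u ∈ weightSpace A d q (-wt u) := by
  induction u with
  | nil => rw [wt_nil, neg_zero]; exact one_mem (Uzero A d q)
  | cons i u ih =>
    rw [Fword_cons, wt_cons, neg_add]
    exact mul_mem_weightSpace hq0 (F_mem_weightSpace i) ih

theorem zpow_injective (hq0 : q ≠ 0) (hq : ∀ n : ℕ, 0 < n → q ^ n ≠ 1) :
    Function.Injective fun n : ℤ => q ^ n := by
  have key : ∀ n : ℕ, 0 < n → q ^ (n : ℤ) ≠ 1 := fun n hn => by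
    rw [zpow_natCast]; exact hq n hn
  intro a b hab
  have h1 : q ^ (a - b) = 1 := by
    rw [zpow_sub₀ hq0, show q ^ a = q ^ b from hab]; exact div_self (zpow_ne_zero _ hq0)
  by_contra hne
  rcases lt_or_gt_of_ne hne with h | h
  · refine key (b - a).toNat (by omega) ?_
    rw [Int.toNat_of_nonneg (by omega), ← neg_sub, zpow_neg, h1, inv_one]
  · refine key (a - b).toNat (by omega) ?_
    rw [Int.toNat_of_nonneg (by omega), h1]

/-- A positive definite matrix is invertible. -/
theorem rootPairing_injective (hA : IsFiniteCartanDatum A d) :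
    Function.Injective fun (γ : ι → ℤ) i => rootPairing A d i γ := by
  intro γ δ h
  have h1 := Matrix.mulVec_injective_iff_isUnit.mpr hA.posDef.isUnit
  have h2 : (fun i => (γ i : ℝ)) = fun i => (δ i : ℝ) := by
    apply h1
    ext i
    have := congrFun h i
    simp only [rootPairing] at this
    simp only [Matrix.mulVec, dotProduct, Matrix.of_apply]
    exact_mod_cast this
  ext i
  exact_mod_cast congrFun h2 i

/-- These are joint eigenspaces of the commuting conjugations by the K_i. Distinct γ have distinct
eigenvalue systems, as q is not a root of unity and the form is nondegenerate. -/
theorem iSupIndep_weightSpace (hA : IsFiniteCartanDatum A d) (hq0 : q ≠ 0)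
    (hq : ∀ n : ℕ, 0 < n → q ^ n ≠ 1) : iSupIndep (weightSpace A d q) := by
  let f (i : ι) : Module.End ℂ (U A d q) :=
    (LinearMap.mulLeft ℂ (K A d q i)).comp (LinearMap.mulRight ℂ (Kinv A d q i))
  have hf (i : ι) (x : U A d q) : f i x = K A d q i * (x * Kinv A d q i) := rfl
  have hcomm (i j : ι) : Commute (f i) (f j) := by
    have h := isPreRep_U A d q
    refine LinearMap.ext fun x => ?_
    rw [Module.End.mul_apply, Module.End.mul_apply, hf, hf, hf, hf, mul_assoc (K A d q j), mul_assoc x,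
      h.k'_k' j i, ← mul_assoc, h.k_k i j]
    simp only [mul_assoc]
  have hind := Module.End.independent_iInf_maxGenEigenspace_of_forall_mapsTo f fun i j φ =>
    Module.End.mapsTo_maxGenEigenspace_of_comm (hcomm j i) φ
  have hinj : Function.Injective fun (γ : ι → ℤ) i => q ^ rootPairing A d i γ := by
    intro γ δ h
    exact rootPairing_injective hA (funext fun i => zpow_injective hq0 hq (congrFun h i))
  refine (hind.comp hinj).mono fun γ x hx => ?_
  simp only [Function.comp_apply, Submodule.mem_iInf]
  intro i
  refine Module.End.mem_maxGenEigenspace _ _ _ |>.mpr ⟨1, ?_⟩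
  rw [pow_one, LinearMap.sub_apply, hf, ← mul_assoc, hx i]
  simp

/-- Turns a spanning set of homogeneous elements into spanning sets of the single weight spaces. -/
theorem iSupIndep.mem_of_mem_iSup {κ V : Type*} [AddCommGroup V] [Module ℂ V]
    {f p : κ → Submodule ℂ V} (hf : iSupIndep f) (hp : ∀ i, p i ≤ f i) {x : V}
    (hx : x ∈ ⨆ i, p i) {i : κ} (hi : x ∈ f i) : x ∈ p i := by
  classical
  have h1 : (⨆ i, p i) ≤ p i ⊔ ⨆ (j) (_ : j ≠ i), f j := by
    refine iSup_le fun j => ?_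
    by_cases h : j = i
    · subst h; exact le_sup_left
    · exact le_sup_of_le_right ((hp j).trans (le_iSup₂_of_le j h le_rfl))
  obtain ⟨y, hy, z, hz, rfl⟩ := Submodule.mem_sup.mp (h1 hx)
  have h2 : z ∈ f i := by simpa using sub_mem hi (hp i hy)
  rw [Submodule.disjoint_def.mp (hf i) z h2 hz, add_zero]
  exact hy

theorem adjoin_range_eq_span {κ R : Type*} [Ring R] [Algebra ℂ R] (g : κ → R) :
    Subalgebra.toSubmodule (Algebra.adjoin ℂ (Set.range g)) =
      Submodule.span ℂ (Set.range fun u : List κ => (u.map g).prod) := by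
  rw [Algebra.adjoin_eq_span]
  congr 1
  ext x
  constructor
  · intro hx
    induction hx using Submonoid.closure_induction with
    | mem y hy => obtain ⟨i, rfl⟩ := hy; exact ⟨[i], by simp⟩
    | one => exact ⟨[], rfl⟩
    | mul y z _ _ hy hz =>
      obtain ⟨u, rfl⟩ := hy
      obtain ⟨v, rfl⟩ := hz
      exact ⟨u ++ v, by simp⟩
  · rintro ⟨u, rfl⟩
    refine list_prod_mem fun y hy => ?_
    obtain ⟨i, _, rfl⟩ := List.mem_map.mp hy
    exact Submonoid.subset_closure ⟨i, rfl⟩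

theorem UplusWeight_eq_span (hA : IsFiniteCartanDatum A d) (hq0 : q ≠ 0)
    (hq : ∀ n : ℕ, 0 < n → q ^ n ≠ 1) (σ : ι → ℤ) :
    UplusWeight A d q σ = Submodule.span ℂ (Eword A d q '' {u | wt u = σ}) := by
  have hp (τ : ι → ℤ) : Submodule.span ℂ (Eword A d q '' {u | wt u = τ}) ≤
      weightSpace A d q τ := by
    rw [Submodule.span_le]
    rintro _ ⟨u, rfl, rfl⟩
    exact Eword_mem_weightSpace hq0 u
  refine le_antisymm ?_ (le_inf ?_ (hp σ))
  · rintro x ⟨hx, hσ⟩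
    refine iSupIndep.mem_of_mem_iSup (iSupIndep_weightSpace hA hq0 hq) hp ?_ hσ
    have hx : x ∈ Submodule.span ℂ (Set.range (Eword A d q)) := by
      rw [Uplus, adjoin_range_eq_span] at hx; exact hx
    refine Submodule.span_le.mpr ?_ hx
    rintro _ ⟨u, rfl⟩
    exact Submodule.mem_iSup_of_mem (wt u) (Submodule.subset_span ⟨u, rfl, rfl⟩)
  · rw [Uplus, adjoin_range_eq_span]
    exact Submodule.span_mono (by rintro _ ⟨u, _, rfl⟩; exact ⟨u, rfl⟩)

theorem UminusWeight_eq_span (hA : IsFiniteCartanDatum A d) (hq0 : q ≠ 0)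
    (hq : ∀ n : ℕ, 0 < n → q ^ n ≠ 1) (σ : ι → ℤ) :
    UminusWeight A d q (-σ) = Submodule.span ℂ (Fword A d q '' {u | wt u = σ}) := by
  have hp (τ : ι → ℤ) : Submodule.span ℂ (Fword A d q '' {u | wt u = τ}) ≤
      weightSpace A d q (-τ) := by
    rw [Submodule.span_le]
    rintro _ ⟨u, rfl, rfl⟩
    exact Fword_mem_weightSpace hq0 u
  refine le_antisymm ?_ (le_inf ?_ (hp σ))
  · rintro x ⟨hx, hσ⟩
    refine iSupIndep.mem_of_mem_iSup ((iSupIndep_weightSpace hA hq0 hq).comp neg_injective) hp ?_ hσ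
    have hx : x ∈ Submodule.span ℂ (Set.range (Fword A d q)) := by
      rw [Uminus, adjoin_range_eq_span] at hx; exact hx
    refine Submodule.span_le.mpr ?_ hx
    rintro _ ⟨u, rfl⟩
    exact Submodule.mem_iSup_of_mem (wt u) (Submodule.subset_span ⟨u, rfl, rfl⟩)
  · rw [Uminus, adjoin_range_eq_span]
    exact Submodule.span_mono (by rintro _ ⟨u, _, rfl⟩; exact ⟨u, rfl⟩)

theorem component_zero_eq (hA : IsFiniteCartanDatum A d) (hq0 : q ≠ 0)
    (hq : ∀ n : ℕ, 0 < n → q ^ n ≠ 1) (σ : ι → ℤ) :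
    component A d q 0 σ = triangularSpan A d q fun u v => wt u = σ ∧ wt v = σ := by
  rw [component, zero_sub, UplusWeight_eq_span hA hq0 hq, UminusWeight_eq_span hA hq0 hq,
    ← Submodule.span_eq (Subalgebra.toSubmodule (Ucartan A d q)), Submodule.span_mul_span,
    Submodule.span_mul_span, triangularSpan]
  congr 1
  ext x
  constructor
  · rintro ⟨_, ⟨_, ⟨u, hu, rfl⟩, k, hk, rfl⟩, _, ⟨v, hv, rfl⟩, rfl⟩
    exact ⟨u, v, ⟨hu, hv⟩, k, hk, rfl⟩
  · rintro ⟨u, v, ⟨hu, hv⟩, k, hk, rfl⟩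
    exact ⟨_, ⟨_, ⟨u, hu, rfl⟩, k, hk, rfl⟩, _, ⟨v, hv, rfl⟩, rfl⟩

theorem iSup_component_zero_eq (hA : IsFiniteCartanDatum A d) (hq0 : q ≠ 0)
    (hq : ∀ n : ℕ, 0 < n → q ^ n ≠ 1) (T : Set (ι → ℤ)) :
    ⨆ σ ∈ T, component A d q 0 σ = triangularSpan A d q fun u v => wt u = wt v ∧ wt u ∈ T := by
  refine le_antisymm (iSup₂_le fun σ hσ => ?_) (triangularSpan_le fun u v huv k hk => ?_)
  · rw [component_zero_eq hA hq0 hq]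
    refine triangularSpan_mono ?_
    rintro u v ⟨rfl, huv⟩
    exact ⟨huv.symm, hσ⟩
  · refine Submodule.mem_iSup_of_mem (wt u) (Submodule.mem_iSup_of_mem huv.2 ?_)
    rw [component_zero_eq hA hq0 hq]
    exact mem_triangularSpan ⟨rfl, huv.1.symm⟩ hk

theorem triangular_mem_weightSpace (hq0 : q ≠ 0) (u v : List ι) {k : U A d q}
    (hk : k ∈ Ucartan A d q) :
    Eword A d q u * k * Fword A d q v ∈ weightSpace A d q (wt u - wt v) := by
  have := mul_mem_weightSpace hq0 (mul_mem_weightSpace hq0 (Eword_mem_weightSpace hq0 u)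
    (Ucartan_le_Uzero hk)) (Fword_mem_weightSpace hq0 v)
  rwa [add_zero, ← sub_eq_add_neg] at this

theorem Uzero_eq_triangularSpan (hA : IsFiniteCartanDatum A d) (hq0 : q ≠ 0)
    (hq : ∀ n : ℕ, 0 < n → q ^ n ≠ 1) :
    Subalgebra.toSubmodule (Uzero A d q) = triangularSpan A d q fun u v => wt u = wt v := by
  refine le_antisymm (fun x hx => ?_) (triangularSpan_le fun u v huv k hk => ?_)
  · have hp (γ : ι → ℤ) : triangularSpan A d q (fun u v => wt u - wt v = γ) ≤
        weightSpace A d q γ := by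
      refine triangularSpan_le fun u v huv k hk => ?_
      rw [← huv]
      exact triangular_mem_weightSpace hq0 u v hk
    have h1 : x ∈ ⨆ γ, triangularSpan A d q (fun u v => wt u - wt v = γ) := by
      have h2 : triangularSpan A d q (fun _ _ => True) ≤
          ⨆ γ, triangularSpan A d q (fun u v => wt u - wt v = γ) :=
        triangularSpan_le fun u v _ k hk =>
          Submodule.mem_iSup_of_mem (wt u - wt v)
            (mem_triangularSpan (p := fun u' v' => wt u' - wt v' = wt u - wt v) rfl hk)
      rw [triangularSpan_eq_top hq0] at h2
      exact h2 trivial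
    have := iSupIndep.mem_of_mem_iSup (iSupIndep_weightSpace hA hq0 hq) hp h1 (i := 0) hx
    exact triangularSpan_mono (fun u v huv => sub_eq_zero.mp huv) this
  · have := triangular_mem_weightSpace hq0 u v hk
    rw [huv, sub_self] at this
    exact this

theorem UzeroOf_eq (hA : IsFiniteCartanDatum A d) (hq0 : q ≠ 0)
    (hq : ∀ n : ℕ, 0 < n → q ^ n ≠ 1) (S : Set ι) :
    UzeroOf A d q S = triangularSpan A d q fun u v => wt u = wt v ∧ wt u ∈ QplusOf S :=
  iSup_component_zero_eq hA hq0 hq _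

theorem idealOf_eq (hA : IsFiniteCartanDatum A d) (hq0 : q ≠ 0)
    (hq : ∀ n : ℕ, 0 < n → q ^ n ≠ 1) (S : Set ι) :
    idealOf A d q S = triangularSpan A d q fun u v => wt u = wt v ∧ wt u ∈ QplusCompl S :=
  iSup_component_zero_eq hA hq0 hq _

theorem UzeroOf_sup_idealOf (hA : IsFiniteCartanDatum A d) (hq0 : q ≠ 0)
    (hq : ∀ n : ℕ, 0 < n → q ^ n ≠ 1) (S : Set ι) :
    UzeroOf A d q S ⊔ idealOf A d q S = Subalgebra.toSubmodule (Uzero A d q) := by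
  rw [UzeroOf_eq hA hq0 hq, idealOf_eq hA hq0 hq, Uzero_eq_triangularSpan hA hq0 hq]
  refine le_antisymm (sup_le (triangularSpan_mono fun _ _ h => h.1)
    (triangularSpan_mono fun _ _ h => h.1)) (triangularSpan_le fun u v huv k hk => ?_)
  by_cases h : ∃ i, i ∉ S ∧ 0 < wt u i
  · exact Submodule.mem_sup_right (mem_triangularSpan ⟨huv, wt_nonneg u, h⟩ hk)
  · push Not at h
    exact Submodule.mem_sup_left (mem_triangularSpan
      ⟨huv, wt_nonneg u, fun i hi => le_antisymm (h i hi) (wt_nonneg u i)⟩ hk)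

theorem mul_mem_idealOf (hA : IsFiniteCartanDatum A d) (hq0 : q ≠ 0)
    (hq : ∀ n : ℕ, 0 < n → q ^ n ≠ 1) (S : Set ι) {x y : U A d q} (hx : x ∈ Uzero A d q)
    (hy : y ∈ idealOf A d q S) : x * y ∈ idealOf A d q S ∧ y * x ∈ idealOf A d q S := by
  have hx : x ∈ Subalgebra.toSubmodule (Uzero A d q) := hx
  rw [Uzero_eq_triangularSpan hA hq0 hq] at hx
  rw [idealOf_eq hA hq0 hq] at hy ⊢
  constructor
  · refine mul_mem_of_triangularSpan₂ hq0 (fun _ _ h => h) (fun _ _ h => h.1) ?_ hx hy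
    intro u v u' v' a b _ ⟨_, _, i, hi, hpos⟩ hab _ hle _
    exact ⟨hab, wt_nonneg a, i, hi, hpos.trans_le (hle i)⟩
  · refine mul_mem_of_triangularSpan₂ hq0 (fun _ _ h => h.1) (fun _ _ h => h) ?_ hy hx
    intro u v u' v' a b ⟨_, _, i, hi, hpos⟩ _ hab hle _ _
    exact ⟨hab, wt_nonneg a, i, hi, hpos.trans_le (hle i)⟩

theorem mul_mem_UzeroOf (hA : IsFiniteCartanDatum A d) (hq0 : q ≠ 0)
    (hq : ∀ n : ℕ, 0 < n → q ^ n ≠ 1) (S : Set ι) {x y : U A d q} (hx : x ∈ UzeroOf A d q S)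
    (hy : y ∈ UzeroOf A d q S) : x * y ∈ UzeroOf A d q S := by
  rw [UzeroOf_eq hA hq0 hq] at hx hy ⊢
  refine mul_mem_of_triangularSpan₂ hq0 (fun _ _ h => h.1) (fun _ _ h => h.1) ?_ hx hy
  intro u v u' v' a b ⟨_, _, h1⟩ ⟨_, _, h2⟩ hab _ _ hle
  refine ⟨hab, wt_nonneg a, fun i hi => le_antisymm ?_ (wt_nonneg a i)⟩
  simpa [h1 i hi, h2 i hi] using hle i

theorem Ucartan_le_UzeroOf (hA : IsFiniteCartanDatum A d) (hq0 : q ≠ 0)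
    (hq : ∀ n : ℕ, 0 < n → q ^ n ≠ 1) (S : Set ι) {k : U A d q} (hk : k ∈ Ucartan A d q) :
    k ∈ UzeroOf A d q S := by
  rw [UzeroOf_eq hA hq0 hq]
  have := mem_triangularSpan (A := A) (d := d) (q := q)
    (p := fun u v => wt u = wt v ∧ wt u ∈ QplusOf S) (u := []) (v := [])
    ⟨rfl, fun _ => le_rfl, fun _ _ => rfl⟩ hk
  rwa [Eword_nil, Fword_nil, one_mul, mul_one] at this

end WeightDecomposition

/-! ### Laurent monomials in the K_i and their values on weight vectors. -/

section Torus

variable {ι : Type*} [DecidableEq ι]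

theorem list_prod_zpow_add {ι G : Type*} [Group G] {g : ι → G} (hg : ∀ i j, Commute (g i) (g j))
    (μ ν : ι → ℤ) (L : List ι) : (L.map fun i => g i ^ (μ + ν) i).prod =
      (L.map fun i => g i ^ μ i).prod * (L.map fun i => g i ^ ν i).prod := by
  induction L with
  | nil => simp
  | cons i L ih =>
    have h : Commute (g i ^ ν i) (L.map fun i => g i ^ μ i).prod := by
      refine Commute.list_prod_right _ _ fun x hx => ?_
      obtain ⟨j, _, rfl⟩ := List.mem_map.mp hx
      exact (hg i j).zpow_zpow _ _
    rw [List.map_cons, List.prod_cons, ih, List.map_cons, List.prod_cons, List.map_cons,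
      List.prod_cons, Pi.add_apply, zpow_add]
    rw [mul_assoc, mul_assoc, ← mul_assoc (g i ^ ν i), h.eq, mul_assoc]

theorem list_prod_zpow_single {G : Type*} [Group G] (g : ι → G) (i : ι) (n : ℤ) {L : List ι}
    (hL : L.Nodup) : (L.map fun j => g j ^ (Pi.single i n : ι → ℤ) j).prod =
      if i ∈ L then g i ^ n else 1 := by
  induction L with
  | nil => simp
  | cons j L ih =>
    rw [List.nodup_cons] at hL
    rw [List.map_cons, List.prod_cons, ih hL.2]
    by_cases h : i = j
    · subst h
      simp [hL.1]
    · rw [Pi.single_eq_of_ne (Ne.symm h)]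
      simp [h]

theorem Kinv_apply {A : Matrix ι ι ℤ} {d : ι → ℕ} {q : ℂ} {M : Type*} [AddCommGroup M] [Module ℂ M]
    {ρ : U A d q →ₐ[ℂ] Module.End ℂ M} {v : M} {l : ι → ℤ} (hq0 : q ≠ 0) {i : ι} (hK : ρ (K A d q i) v = q ^ l i • v) :
    ρ (Kinv A d q i) v = q ^ (-l i) • v := by
  have h : ρ (Kinv A d q i) (ρ (K A d q i) v) = v := by
    rw [← Module.End.mul_apply, ← map_mul, Kinv_mul_K, map_one, Module.End.one_apply]
  rw [hK, map_smul] at h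
  rw [← h, smul_smul, h, zpow_neg, inv_mul_cancel₀ (zpow_ne_zero _ hq0), one_smul]

/-- `K_i` as a unit. -/
def KUnit (A : Matrix ι ι ℤ) (d : ι → ℕ) (q : ℂ) (i : ι) : (U A d q)ˣ := ⟨K A d q i, Kinv A d q i, K_mul_Kinv A d q i, Kinv_mul_K A d q i⟩

theorem zpow_KUnit_apply {A : Matrix ι ι ℤ} {d : ι → ℕ} {q : ℂ} {M : Type*} [AddCommGroup M]
    [Module ℂ M] {ρ : U A d q →ₐ[ℂ] Module.End ℂ M} {v : M} {l : ι → ℤ} (hq0 : q ≠ 0) {i : ι} (hK : ρ (K A d q i) v = q ^ l i • v) (n : ℤ) :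
    ρ (KUnit A d q i ^ n : (U A d q)ˣ) v = q ^ (l i * n) • v := by
  induction n using Int.induction_on with
  | zero => simp
  | succ n ih =>
    rw [zpow_add_one, Units.val_mul, map_mul, Module.End.mul_apply]
    change ρ _ (ρ (K A d q i) v) = _
    rw [hK, map_smul, ih, smul_smul, ← zpow_add₀ hq0]
    congr 2; ring
  | pred n ih =>
    rw [zpow_sub_one, Units.val_mul, map_mul, Module.End.mul_apply]
    change ρ _ (ρ (Kinv A d q i) v) = _
    rw [Kinv_apply hq0 hK, map_smul, ih, smul_smul, ← zpow_add₀ hq0]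
    congr 2; ring

variable [Fintype ι] {A : Matrix ι ι ℤ} {d : ι → ℕ} {q : ℂ}

variable (A d q) in
/-- The monomial `∏ K_i ^ μ_i`. -/
def Kmonomial (μ : ι → ℤ) : U A d q :=
  ((Finset.univ.toList.map fun i => KUnit A d q i ^ μ i).prod : (U A d q)ˣ)

theorem Kmonomial_add (μ ν : ι → ℤ) :
    Kmonomial A d q (μ + ν) = Kmonomial A d q μ * Kmonomial A d q ν := by
  rw [Kmonomial, list_prod_zpow_add (fun i j => Units.ext ((isPreRep_U A d q).k_k i j)),
    Units.val_mul]
  rfl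

theorem Kmonomial_single (i : ι) (n : ℤ) :
    Kmonomial A d q (Pi.single i n) = (KUnit A d q i ^ n : (U A d q)ˣ) := by
  rw [Kmonomial, list_prod_zpow_single _ _ _ (Finset.nodup_toList _), if_pos (by simp)]

theorem Kmonomial_zero : Kmonomial A d q 0 = 1 := by simp [Kmonomial]

theorem mem_span_Kmonomial {k : U A d q} (hk : k ∈ Ucartan A d q) :
    k ∈ Submodule.span ℂ (Set.range (Kmonomial A d q)) := by
  induction hk using Algebra.adjoin_induction with
  | mem y hy =>
    refine Submodule.subset_span ?_
    rcases hy with ⟨i, rfl⟩ | ⟨i, rfl⟩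
    · exact ⟨Pi.single i 1, by rw [Kmonomial_single, zpow_one]; rfl⟩
    · exact ⟨Pi.single i (-1), by rw [Kmonomial_single, zpow_neg_one]; rfl⟩
  | algebraMap r =>
    rw [Algebra.algebraMap_eq_smul_one, ← Kmonomial_zero]
    exact Submodule.smul_mem _ r (Submodule.subset_span ⟨0, rfl⟩)
  | add y z _ _ hy hz => exact add_mem hy hz
  | mul y z _ _ hy hz =>
    have h := Submodule.mul_mem_mul hy hz
    rw [Submodule.span_mul_span] at h
    refine Submodule.span_mono ?_ h
    rintro _ ⟨_, ⟨μ, rfl⟩, _, ⟨ν, rfl⟩, rfl⟩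
    exact ⟨μ + ν, Kmonomial_add μ ν⟩

section Action

variable {M : Type*} [AddCommGroup M] [Module ℂ M] {ρ : U A d q →ₐ[ℂ] Module.End ℂ M} {v : M}
  {l : ι → ℤ}

theorem Kmonomial_apply (hq0 : q ≠ 0) (hK : ∀ i, ρ (K A d q i) v = q ^ l i • v) (μ : ι → ℤ) :
    ρ (Kmonomial A d q μ) v = q ^ (∑ i, l i * μ i) • v := by
  have key (L : List ι) : ρ ((L.map fun i => KUnit A d q i ^ μ i).prod : (U A d q)ˣ) v =
      q ^ ((L.map fun i => l i * μ i).sum) • v := by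
    induction L with
    | nil => simp
    | cons i L ih =>
      rw [List.map_cons, List.prod_cons, Units.val_mul, map_mul, Module.End.mul_apply, ih, map_smul,
        zpow_KUnit_apply hq0 (hK i), smul_smul, ← zpow_add₀ hq0, List.map_cons, List.sum_cons,
        add_comm]
  rw [Kmonomial, key, Finset.sum_map_toList]

end Action

/-- A Laurent polynomial in the `K_i` is determined by its values at the positive integral
weights. -/
theorem exists_eval_Ucartan (hq0 : q ≠ 0) (hq : ∀ n : ℕ, 0 < n → q ^ n ≠ 1) {k : U A d q}
    (hk : k ∈ Ucartan A d q) : ∃ f : (ι → ℤ) → ℂ,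
      (∀ (N : Submodule ℂ (List ι →₀ ℂ)) (ρ : U A d q →ₐ[ℂ] Module.End ℂ ((List ι →₀ ℂ) ⧸ N))
        (v : (List ι →₀ ℂ) ⧸ N) (l : ι → ℤ), (∀ i, ρ (K A d q i) v = q ^ l i • v) →
          ρ k v = f l • v) ∧
      ((∀ l, (∀ i, 1 ≤ l i) → f l = 0) → k = 0) := by
  obtain ⟨g, hg⟩ := Finsupp.mem_span_range_iff_exists_finsupp.mp (mem_span_Kmonomial hk)
  refine ⟨fun l => ∑ μ ∈ g.support, g μ * q ^ (∑ i, l i * μ i), ?_, ?_⟩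
  · intro N ρ v l hK
    rw [← hg, Finsupp.sum, map_sum, LinearMap.sum_apply, Finset.sum_smul]
    refine Finset.sum_congr rfl fun μ _ => ?_
    rw [map_smul, LinearMap.smul_apply, Kmonomial_apply hq0 hK, smul_smul]
  · intro h
    -- The positive weights are l = 1 + n with n in ℕ^ι. On them a monomial is a constant times a
    -- character of the monoid ℕ^ι; distinct μ give distinct characters, so linear independence of
    -- characters kills all coefficients.
    let χ (μ : ι → ℤ) : Multiplicative (ι → ℕ) →* ℂ :=
      { toFun := fun n => q ^ (∑ i, (n.toAdd i : ℤ) * μ i)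
        map_one' := by simp
        map_mul' := fun m n => by
          rw [← zpow_add₀ hq0, ← Finset.sum_add_distrib]
          congr 1
          refine Finset.sum_congr rfl fun i _ => ?_
          rw [toAdd_mul, Pi.add_apply]; push_cast; ring }
    have hχ (μ : ι → ℤ) (n : Multiplicative (ι → ℕ)) :
        χ μ n = q ^ (∑ i, (n.toAdd i : ℤ) * μ i) := rfl
    have hinj : Function.Injective χ := by
      intro μ ν hμν
      ext i
      have h1 := DFunLike.congr_fun hμν (Multiplicative.ofAdd (Pi.single i 1))
      rw [hχ, hχ] at h1
      simpa [Pi.single_apply] using zpow_injective hq0 hq h1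
    have hind := (linearIndependent_monoidHom (Multiplicative (ι → ℕ)) ℂ).comp χ hinj
    have hzero := linearIndependent_iff'.mp hind g.support
      (fun μ => g μ * q ^ (∑ i, μ i)) (by
        ext n
        rw [Finset.sum_apply, Pi.zero_apply, ← h (fun i => 1 + (n.toAdd i : ℤ)) (by simp)]
        refine Finset.sum_congr rfl fun μ _ => ?_
        simp only [Pi.smul_apply, Function.comp_apply, hχ, smul_eq_mul]
        rw [mul_assoc, ← zpow_add₀ hq0, ← Finset.sum_add_distrib]
        simp only [add_mul, one_mul])
    rw [← hg, Finsupp.sum]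
    refine Finset.sum_eq_zero fun μ hμ => ?_
    have := (mul_eq_zero.mp (hzero μ hμ)).resolve_right (zpow_ne_zero _ hq0)
    rw [this, zero_smul]

end Torus

/-! ### Lowering E_u v when the letters of u are mutually orthogonal. -/

section LowestWeight

variable {ι : Type*} [Fintype ι] [DecidableEq ι] {A : Matrix ι ι ℤ} {d : ι → ℕ} {q : ℂ}
  {M : Type*} [AddCommGroup M] [Module ℂ M] {ρ : U A d q →ₐ[ℂ] Module.End ℂ M} {v : M}
  {l : ι → ℤ} {S : Set ι}

theorem K_Eword_apply (hq0 : q ≠ 0) (hK : ∀ i, ρ (K A d q i) v = q ^ l i • v) (i : ι)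
    (u : List ι) : ρ (K A d q i) (ρ (Eword A d q u) v) =
      q ^ (l i + rootPairing A d i (wt u)) • ρ (Eword A d q u) v := by
  have h := Eword_mem_weightSpace (A := A) (d := d) hq0 u i
  have h : K A d q i * Eword A d q u =
      q ^ rootPairing A d i (wt u) • (Eword A d q u * K A d q i) := by
    rw [← smul_mul_assoc, ← h, mul_assoc _ (Kinv A d q i), Kinv_mul_K, mul_one]
  rw [← Module.End.mul_apply, ← map_mul, h, map_smul, LinearMap.smul_apply, map_mul,
    Module.End.mul_apply, hK, map_smul, smul_smul, ← zpow_add₀ hq0, add_comm]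

theorem cartanH_Eword_apply (hq0 : q ≠ 0) (hK : ∀ i, ρ (K A d q i) v = q ^ l i • v) (i : ι)
    (u : List ι) : ρ (cartanH A d q i) (ρ (Eword A d q u) v) =
      ((q ^ d i - (q ^ d i)⁻¹)⁻¹ * (q ^ (l i + rootPairing A d i (wt u)) -
        q ^ (-(l i + rootPairing A d i (wt u))))) • ρ (Eword A d q u) v := by
  rw [cartanH, map_smul, map_sub, LinearMap.smul_apply, LinearMap.sub_apply,
    Kinv_apply (l := fun i => l i + rootPairing A d i (wt u)) hq0 (K_Eword_apply hq0 hK i u),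
    K_Eword_apply hq0 hK, ← sub_smul, smul_smul]

theorem rootPairing_wt_of_orthogonal (hA : IsFiniteCartanDatum A d)
    (hS : ∀ i ∈ S, ∀ j ∈ S, i ≠ j → A i j = 0) {i : ι} (hi : i ∈ S) {u : List ι}
    (hu : ∀ j ∈ u, j ∈ S) : rootPairing A d i (wt u) = 2 * d i * u.count i := by
  rw [rootPairing, Finset.sum_eq_single i, hA.diag, wt]
  · ring
  · intro j _ hj
    by_cases hju : j ∈ u
    · rw [hS i hi j (hu j hju) (Ne.symm hj), mul_zero, zero_mul]
    · rw [wt, List.count_eq_zero_of_not_mem hju, Nat.cast_zero, mul_zero]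
  · intro h; exact absurd (Finset.mem_univ i) h

/-- Each letter i met by F_i contributes the value of (K_i - K_i⁻¹)/(q_i - q_i⁻¹) on the letters to
its right. By orthogonality that value only depends on the number m of letters i among them. -/
theorem F_Eword_apply (hA : IsFiniteCartanDatum A d) (hq0 : q ≠ 0)
    (hS : ∀ i ∈ S, ∀ j ∈ S, i ≠ j → A i j = 0)
    (hcomm : ∀ i ∈ S, ∀ j ∈ S, Commute (E A d q i) (E A d q j))
    (hF : ∀ i, ρ (F A d q i) v = 0) (hK : ∀ i, ρ (K A d q i) v = q ^ l i • v) {i : ι} (hi : i ∈ S)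
    {u : List ι} (hu : ∀ j ∈ u, j ∈ S) :
    ρ (F A d q i) (ρ (Eword A d q u) v) = -(∑ m ∈ Finset.range (u.count i),
      (q ^ d i - (q ^ d i)⁻¹)⁻¹ * (q ^ (l i + 2 * d i * m) - q ^ (-(l i + 2 * d i * m)))) •
        ρ (Eword A d q (u.erase i)) v := by
  induction u with
  | nil => simp [Eword_nil, hF]
  | cons j u ih =>
    have hu' : ∀ j ∈ u, j ∈ S := fun j hj => hu j (List.mem_cons_of_mem _ hj)
    have ih := ih hu'
    rw [Eword_cons, ← Module.End.mul_apply, ← map_mul, ← mul_assoc, F_mul_E, sub_mul, map_sub,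
      LinearMap.sub_apply, mul_assoc, map_mul, Module.End.mul_apply, map_mul ρ (F A d q i),
      Module.End.mul_apply, ih, map_smul, ← Module.End.mul_apply, ← map_mul, ← Eword_cons]
    by_cases hji : j = i
    · subst hji
      -- Either the inductive sum is empty, or the erased letter can be put back in front because
      -- the E's commute.
      have hperm : (u.count j = 0) ∨ Eword A d q (j :: u.erase j) = Eword A d q u := by
        by_cases hju : j ∈ u
        · right
          exact (Eword_perm hcomm (List.perm_cons_erase hju) hu').symm
        · left; exact List.count_eq_zero_of_not_mem hju
      rw [if_pos rfl, map_mul, Module.End.mul_apply, cartanH_Eword_apply hq0 hK,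
        rootPairing_wt_of_orthogonal hA hS hi hu', List.erase_cons_head, List.count_cons_self,
        Finset.sum_range_succ]
      rcases hperm with h0 | h1
      · rw [h0]; simp
      · rw [h1, ← sub_smul]
        congr 1
        ring
    · rw [if_neg hji, zero_mul, map_zero, LinearMap.zero_apply, sub_zero,
        List.erase_cons_tail (by simpa using hji), List.count_cons_of_ne hji]

/-- Up to nonzero factors the sum is a product of two differences x - x⁻¹, with x = q^(en) and x =
q^(a + e(n-1)). Both exponents are positive, the second because a ≥ 1. -/
theorem sum_qNumbers_ne_zero (hq0 : q ≠ 0) (hq : ∀ n : ℕ, 0 < n → q ^ n ≠ 1) {e n : ℕ}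
    (he : 0 < e) (hn : 0 < n) {a : ℤ} (ha : 1 ≤ a) : ∑ m ∈ Finset.range n,
      (q ^ e - (q ^ e)⁻¹)⁻¹ * (q ^ (a + 2 * e * m) - q ^ (-(a + 2 * e * m))) ≠ 0 := by
  have hne : q ^ e - (q ^ e)⁻¹ ≠ 0 := sub_inv_ne_zero hq0 hq he
  have key (n : ℕ) : (q ^ e - (q ^ e)⁻¹) * ∑ m ∈ Finset.range n,
      (q ^ (a + 2 * e * m) - q ^ (-(a + 2 * e * m))) =
        (q ^ (e * n) - (q ^ (e * n))⁻¹) * (q ^ (a + e * n - e) - (q ^ (a + e * n - e))⁻¹) := by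
    induction n with
    | zero => simp
    | succ n ih =>
      rw [Finset.sum_range_succ, mul_add, ih]
      have e1 : q ^ (a + 2 * e * n) = q ^ a * (q ^ (e * n)) ^ 2 := by
        rw [zpow_add₀ hq0, ← pow_mul, ← zpow_natCast q]; push_cast; ring_nf
      have e2 : q ^ (a + e * n - e) = q ^ a * q ^ (e * n) * (q ^ e)⁻¹ := by
        rw [zpow_sub₀ hq0, zpow_add₀ hq0, ← zpow_natCast q, ← zpow_natCast q]; push_cast; rfl
      have e3 : q ^ (a + e * ((n + 1 : ℕ) : ℤ) - e) = q ^ a * q ^ (e * n) := by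
        rw [← zpow_natCast q, ← zpow_add₀ hq0]; push_cast; ring_nf
      rw [zpow_neg, e1, e2, e3, mul_add, pow_add, mul_one]
      have h1 : q ^ a ≠ 0 := zpow_ne_zero _ hq0
      have h2 : q ^ (e * n) ≠ 0 := pow_ne_zero _ hq0
      have h3 : q ^ e ≠ 0 := pow_ne_zero _ hq0
      generalize q ^ a = x at *
      generalize q ^ (e * n) = y at *
      generalize q ^ e = z at *
      field_simp
      ring
  rw [← Finset.mul_sum]
  refine mul_ne_zero (inv_ne_zero hne) (right_ne_zero_of_mul (a := q ^ e - (q ^ e)⁻¹) ?_)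
  rw [key]
  refine mul_ne_zero (sub_inv_ne_zero hq0 hq (Nat.mul_pos he hn)) ?_
  obtain ⟨n, rfl⟩ : ∃ m, n = m + 1 := ⟨n - 1, by omega⟩
  obtain ⟨a, rfl⟩ : ∃ b : ℕ, a = b := ⟨a.toNat, by omega⟩
  have : ((a : ℤ) + e * ((n + 1 : ℕ) : ℤ) - e) = ((a + e * n : ℕ) : ℤ) := by push_cast; ring
  rw [this, zpow_natCast]
  exact sub_inv_ne_zero hq0 hq (by omega)

theorem exists_Fword_Eword_apply (hA : IsFiniteCartanDatum A d) (hq0 : q ≠ 0)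
    (hq : ∀ n : ℕ, 0 < n → q ^ n ≠ 1) (hS : ∀ i ∈ S, ∀ j ∈ S, i ≠ j → A i j = 0)
    (hcomm : ∀ i ∈ S, ∀ j ∈ S, Commute (E A d q i) (E A d q j))
    (hF : ∀ i, ρ (F A d q i) v = 0) (hK : ∀ i, ρ (K A d q i) v = q ^ l i • v)
    (hl : ∀ i, 1 ≤ l i) {w u : List ι} (hwu : w.Perm u) (hu : ∀ j ∈ u, j ∈ S) :
    ∃ c : ℂ, c ≠ 0 ∧ ρ (Fword A d q w) (ρ (Eword A d q u) v) = c • v := by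
  induction w using List.reverseRecOn generalizing u with
  | nil =>
    rw [List.nil_perm] at hwu
    subst hwu
    exact ⟨1, one_ne_zero, by simp [Fword_nil, Eword_nil]⟩
  | append_singleton w i ih =>
    have hiu : i ∈ u := hwu.mem_iff.mp (by simp)
    have hw : w.Perm (u.erase i) := by
      have h1 : (i :: w).Perm (i :: u.erase i) :=
        ((List.perm_append_singleton i w).symm.trans hwu).trans (List.perm_cons_erase hiu)
      exact h1.cons_inv
    obtain ⟨c, hc, h⟩ := ih hw fun j hj => hu j (List.mem_of_mem_erase hj)
    have hd : 0 < d i := by have := hA.d_mem i; omega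
    refine ⟨_, mul_ne_zero (neg_ne_zero.mpr (sum_qNumbers_ne_zero hq0 hq hd
      (List.count_pos_iff.mpr hiu) (hl i))) hc, ?_⟩
    rw [Fword_append, Fword_cons, Fword_nil, mul_one, map_mul, Module.End.mul_apply,
      F_Eword_apply hA hq0 hS hcomm hF hK (hu i hiu) hu, map_smul, h, smul_smul]

end LowestWeight

/-! ### The subalgebra U_0^S, directness of the sum, and extension of characters. -/

variable {ι : Type*} [DecidableEq ι] {A : Matrix ι ι ℤ} {d : ι → ℕ} {q : ℂ} {S : Set ι}

theorem forall_mem_of_wt_mem {u : List ι} (hu : wt u ∈ QplusOf S) : ∀ i ∈ u, i ∈ S := by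
  intro i hi
  by_contra h
  have h1 := hu.2 i h
  have h2 := List.count_pos_iff.mpr hi
  simp only [wt] at h1
  omega

variable (A d q S) in
/-- The generators `E_i F_i`, `i ∈ S`, and `K_j^{±1}`. -/
def leviGenerators : Set (U A d q) :=
  {x | ∃ i ∈ S, x = E A d q i * F A d q i} ∪ Set.range (K A d q) ∪ Set.range (Kinv A d q)

theorem Ucartan_le_adjoin : Ucartan A d q ≤ Algebra.adjoin ℂ (leviGenerators A d q S) :=
  Algebra.adjoin_mono (Set.union_subset_union_left _ Set.subset_union_right)

theorem adjoin_mul_F (hq0 : q ≠ 0)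
    (hF : ∀ i ∈ S, ∀ j ∈ S, Commute (F A d q i) (F A d q j)) {i : ι} (hi : i ∈ S) {b : U A d q}
    (hb : b ∈ Algebra.adjoin ℂ (leviGenerators A d q S)) :
    ∃ b' ∈ Algebra.adjoin ℂ (leviGenerators A d q S), b * F A d q i = F A d q i * b' := by
  induction hb using Algebra.adjoin_induction with
  | mem y hy =>
    have hcartan {k : U A d q} (hk : k ∈ Ucartan A d q) :
        ∃ b' ∈ Algebra.adjoin ℂ (leviGenerators A d q S), k * F A d q i = F A d q i * b' := by
      obtain ⟨k', hk', h⟩ := Ucartan_mul_F hq0 i hk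
      exact ⟨k', Ucartan_le_adjoin hk', h⟩
    rcases hy with (⟨j, hj, rfl⟩ | ⟨j, rfl⟩) | ⟨j, rfl⟩
    · have hEF : E A d q j * F A d q j ∈ Algebra.adjoin ℂ (leviGenerators A d q S) :=
        Algebra.subset_adjoin (Or.inl (Or.inl ⟨j, hj, rfl⟩))
      by_cases hij : j = i
      · subst hij
        obtain ⟨k', hk', h⟩ := Ucartan_mul_F hq0 j (cartanH_mem (A := A) (d := d) (q := q) j)
        -- With H the commutator of E and F, (EF)F = (FE + H)F = F(EF + k'), where HF = Fk'.
        refine ⟨E A d q j * F A d q j + k', add_mem hEF (Ucartan_le_adjoin hk'), ?_⟩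
        have h1 := F_mul_E (A := A) (d := d) (q := q) j j
        rw [if_pos rfl, eq_sub_iff_add_eq] at h1
        rw [mul_add, ← h, ← mul_assoc, ← add_mul, h1]
      · exact ⟨_, hEF, by rw [mul_assoc, (hF j hj i hi).eq, ← mul_assoc,
          (E_commute_F hij).eq, mul_assoc]⟩
    · exact hcartan (K_mem_Ucartan j)
    · exact hcartan (Kinv_mem_Ucartan j)
  | algebraMap r =>
    exact ⟨_, Subalgebra.algebraMap_mem _ r, Algebra.commutes r _⟩
  | add y z _ _ hy hz =>
    obtain ⟨y', hy', hy⟩ := hy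
    obtain ⟨z', hz', hz⟩ := hz
    exact ⟨y' + z', add_mem hy' hz', by rw [add_mul, hy, hz, mul_add]⟩
  | mul y z _ _ hy hz =>
    obtain ⟨y', hy', hy⟩ := hy
    obtain ⟨z', hz', hz⟩ := hz
    exact ⟨y' * z', mul_mem hy' hz', by rw [mul_assoc, hz, ← mul_assoc, hy, mul_assoc]⟩

/-- Reversing the F-word puts F_i outermost opposite E_i. If b is the inner product, then E_i b F_i
= (E_i F_i) b' by `adjoin_mul_F`. -/
theorem Eword_mul_Fword_mem_adjoin (hq0 : q ≠ 0)
    (hF : ∀ i ∈ S, ∀ j ∈ S, Commute (F A d q i) (F A d q j)) {u : List ι} (hu : ∀ i ∈ u, i ∈ S) :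
    Eword A d q u * Fword A d q u.reverse ∈ Algebra.adjoin ℂ (leviGenerators A d q S) := by
  induction u with
  | nil => rw [List.reverse_nil, Eword_nil, Fword_nil, one_mul]; exact one_mem _
  | cons i u ih =>
    have hi := hu i (by simp)
    obtain ⟨b, hb, h⟩ := adjoin_mul_F hq0 hF hi (ih fun j hj => hu j (List.mem_cons_of_mem _ hj))
    rw [List.reverse_cons, Fword_append, Fword_cons, Fword_nil, mul_one, Eword_cons, mul_assoc,
      ← mul_assoc (Eword A d q u), h, ← mul_assoc]
    exact mul_mem (Algebra.subset_adjoin (Or.inl (Or.inl ⟨i, hi, rfl⟩))) hb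

variable [Fintype ι]

theorem E_commute_of_orthogonal (hA : IsFiniteCartanDatum A d) (hq0 : q ≠ 0)
    (hq : ∀ n : ℕ, 0 < n → q ^ n ≠ 1) (hS : ∀ i ∈ S, ∀ j ∈ S, i ≠ j → A i j = 0) :
    ∀ i ∈ S, ∀ j ∈ S, Commute (E A d q i) (E A d q j) := by
  intro i hi j hj
  by_cases hij : i = j
  · rw [hij]
  · exact E_commute_E hq0 hq (fun i => by have := hA.d_mem i; omega) hij (hS i hi j hj hij)

theorem F_commute_of_orthogonal (hA : IsFiniteCartanDatum A d) (hq0 : q ≠ 0)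
    (hq : ∀ n : ℕ, 0 < n → q ^ n ≠ 1) (hS : ∀ i ∈ S, ∀ j ∈ S, i ≠ j → A i j = 0) :
    ∀ i ∈ S, ∀ j ∈ S, Commute (F A d q i) (F A d q j) := by
  intro i hi j hj
  by_cases hij : i = j
  · rw [hij]
  · exact F_commute_F hq0 hq (fun i => by have := hA.d_mem i; omega) hij (hS i hi j hj hij)

/-- An element of `U_{0,γ}`, `γ ∈ Q⁺_S`, that kills the vectors of weight `γ` above the lowest
weight vector in all lowest weight modules of positive integral lowest weight vanishes. -/
theorem eq_zero_of_apply_eq_zero (hA : IsFiniteCartanDatum A d) (hq0 : q ≠ 0)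
    (hq : ∀ n : ℕ, 0 < n → q ^ n ≠ 1) (hS : ∀ i ∈ S, ∀ j ∈ S, i ≠ j → A i j = 0) {u : List ι}
    (hu : wt u ∈ QplusOf S) {x : U A d q} (hx : x ∈ component A d q 0 (wt u))
    (h : ∀ l : ι → ℤ, (∀ i, 1 ≤ l i) → ∀ (N : Submodule ℂ (List ι →₀ ℂ))
      (ρ : U A d q →ₐ[ℂ] Module.End ℂ ((List ι →₀ ℂ) ⧸ N)) (v : (List ι →₀ ℂ) ⧸ N),
      (∀ i, ρ (F A d q i) v = 0) → (∀ i, ρ (K A d q i) v = q ^ l i • v) →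
        ρ x (ρ (Eword A d q u) v) = 0) : x = 0 := by
  have hE := E_commute_of_orthogonal hA hq0 hq hS
  have hF := F_commute_of_orthogonal hA hq0 hq hS
  have huS := forall_mem_of_wt_mem hu
  -- Words of equal weight in S are permutations of each other and give equal products, so the
  -- component is E_u U⁰ F_u for the single word u.
  obtain ⟨k, hk, rfl⟩ : ∃ k ∈ Ucartan A d q, x = Eword A d q u * k * Fword A d q u := by
    rw [component_zero_eq hA hq0 hq] at hx
    have hle : triangularSpan A d q (fun a b => wt a = wt u ∧ wt b = wt u) ≤
        (Subalgebra.toSubmodule (Ucartan A d q)).map ((LinearMap.mulRight ℂ (Fword A d q u)).comp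
          (LinearMap.mulLeft ℂ (Eword A d q u))) := by
      refine triangularSpan_le fun a b hab k hk => ⟨k, hk, ?_⟩
      rw [← Eword_perm hE (perm_of_wt_eq hab.1.symm) huS,
        ← Fword_perm hF (perm_of_wt_eq hab.2.symm) huS]
      rfl
    obtain ⟨k, hk, hk'⟩ := hle hx
    exact ⟨k, hk, hk'.symm⟩
  obtain ⟨f, hf, hk0⟩ := exists_eval_Ucartan hq0 hq hk
  rw [hk0, mul_zero, zero_mul]
  intro l hl
  obtain ⟨N, ρ, v, hv, hFv, hKv⟩ := exists_lowestWeightModule hA hq0 hq l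
  obtain ⟨c, hc, hcv⟩ :=
    exists_Fword_Eword_apply hA hq0 hq hS hE hFv hKv hl (List.Perm.refl u) huS
  have h0 := h l hl N ρ v hFv hKv
  rw [map_mul, map_mul, Module.End.mul_apply, Module.End.mul_apply, hcv, map_smul, hf N ρ v l hKv,
    map_smul, map_smul] at h0
  -- F_u returns the vector to the lowest weight line, giving c² f(l) v = 0 without having to know
  -- that E_u v is nonzero.
  have h1 := congrArg (ρ (Fword A d q u)) h0
  rw [map_smul, map_smul, hcv, map_zero, smul_smul, smul_smul] at h1
  have h2 := (smul_eq_zero.mp h1).resolve_right hv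
  simpa [hc] using h2

theorem disjoint_UzeroOf_idealOf (hA : IsFiniteCartanDatum A d) (hq0 : q ≠ 0)
    (hq : ∀ n : ℕ, 0 < n → q ^ n ≠ 1) (hS : ∀ i ∈ S, ∀ j ∈ S, i ≠ j → A i j = 0) :
    Disjoint (UzeroOf A d q S) (idealOf A d q S) := by
  rw [Submodule.disjoint_def]
  intro x hx hxI
  obtain ⟨f, hf, rfl⟩ := (Submodule.mem_iSup_iff_exists_finsupp _ _).mp hx
  have hfS (γ : ι → ℤ) (hγ : γ ∈ f.support) : γ ∈ QplusOf S ∧ f γ ∈ component A d q 0 γ := by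
    have h1 := hf γ
    by_cases h : γ ∈ QplusOf S
    · simp only [h, iSup_pos] at h1; exact ⟨h, h1⟩
    · simp only [h, iSup_false, Submodule.mem_bot] at h1
      exact absurd h1 (Finsupp.mem_support_iff.mp hγ)
  by_contra hne
  have hsupp : f.support.Nonempty := by
    rw [Finset.nonempty_iff_ne_empty]
    intro h
    exact hne (by rw [Finsupp.sum, h, Finset.sum_empty])
  -- Minimality ensures that no other occurring weight δ satisfies δ ≤ γ, so the other components
  -- kill E_u v.
  obtain ⟨γ, hγ⟩ := f.support.exists_minimal hsupp
  obtain ⟨hγS, hfγ⟩ := hfS γ hγ.prop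
  have hword : ∃ u : List ι, wt u = γ := by
    by_contra hno
    push Not at hno
    rw [component_zero_eq hA hq0 hq] at hfγ
    have hle : triangularSpan A d q (fun a b => wt a = γ ∧ wt b = γ) ≤ ⊥ :=
      triangularSpan_le fun a _ hab => absurd hab.1 (hno a)
    exact Finsupp.mem_support_iff.mp hγ.prop ((Submodule.mem_bot ℂ).mp (hle hfγ))
  obtain ⟨u, rfl⟩ := hword
  refine Finsupp.mem_support_iff.mp hγ.prop
    (eq_zero_of_apply_eq_zero hA hq0 hq hS hγS hfγ fun l hl N ρ v hFv hKv => ?_)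
  rw [idealOf_eq hA hq0 hq] at hxI
  have h0 := triangularSpan_apply_eq_zero (u := u) hq0 hFv (fun a b hab hle => by
    obtain ⟨hab, _, i, hi, hpos⟩ := hab
    have h1 := hle i
    rw [← hab, hγS.2 i hi] at h1
    exact absurd (hpos.trans_le h1) (lt_irrefl _)) hxI
  rw [Finsupp.sum, map_sum, LinearMap.sum_apply, Finset.sum_eq_single (wt u)] at h0
  · exact h0
  · intro δ hδ hne
    have h1 := (hfS δ hδ).2
    rw [component_zero_eq hA hq0 hq] at h1
    refine triangularSpan_apply_eq_zero hq0 hFv (fun a b hab hle => ?_) h1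
    rw [hab.2] at hle
    exact hne (le_antisymm hle (hγ.le_of_le hδ hle))
  · intro h; exact absurd hγ.prop h

theorem adjoin_leviGenerators (hA : IsFiniteCartanDatum A d) (hq0 : q ≠ 0)
    (hq : ∀ n : ℕ, 0 < n → q ^ n ≠ 1) (hS : ∀ i ∈ S, ∀ j ∈ S, i ≠ j → A i j = 0) :
    Subalgebra.toSubmodule (Algebra.adjoin ℂ (leviGenerators A d q S)) = UzeroOf A d q S := by
  have hE := E_commute_of_orthogonal hA hq0 hq hS
  have hF := F_commute_of_orthogonal hA hq0 hq hS
  refine le_antisymm ?_ ?_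
  · let B : Subalgebra ℂ (U A d q) := (UzeroOf A d q S).toSubalgebra
      (Ucartan_le_UzeroOf hA hq0 hq S (one_mem _)) fun _ _ => mul_mem_UzeroOf hA hq0 hq S
    have hB : Algebra.adjoin ℂ (leviGenerators A d q S) ≤ B := by
      refine Algebra.adjoin_le ?_
      rintro _ ((⟨i, hi, rfl⟩ | ⟨j, rfl⟩) | ⟨j, rfl⟩)
      · change _ ∈ UzeroOf A d q S
        rw [UzeroOf_eq hA hq0 hq]
        have h1 : wt [i] ∈ QplusOf S := by
          refine ⟨wt_nonneg _, fun j hj => ?_⟩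
          have hij : i ≠ j := by rintro rfl; exact hj hi
          simp [wt, hij]
        have := mem_triangularSpan (A := A) (d := d) (q := q)
          (p := fun u v => wt u = wt v ∧ wt u ∈ QplusOf S) (u := [i]) (v := [i]) ⟨rfl, h1⟩
          (one_mem _)
        simpa [Eword_cons, Fword_cons, Eword_nil, Fword_nil] using this
      · exact Ucartan_le_UzeroOf hA hq0 hq S (K_mem_Ucartan j)
      · exact Ucartan_le_UzeroOf hA hq0 hq S (Kinv_mem_Ucartan j)
    exact hB
  · rw [UzeroOf_eq hA hq0 hq]
    refine triangularSpan_le fun u v huv k hk => ?_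
    have huS := forall_mem_of_wt_mem huv.2
    have hv : Fword A d q u.reverse = Fword A d q v :=
      Fword_perm hF ((List.reverse_perm u).trans (perm_of_wt_eq huv.1))
        fun i hi => huS i (List.mem_reverse.mp hi)
    obtain ⟨k', hk', h⟩ := Ucartan_mul_Fword hq0 v hk
    -- k is moved to the far right, and v is reordered into the reverse of u, to reach the form of
    -- `Eword_mul_Fword_mem_adjoin`.
    rw [mul_assoc, h, ← hv, ← mul_assoc]
    change _ ∈ Algebra.adjoin ℂ (leviGenerators A d q S)
    exact mul_mem (Eword_mul_Fword_mem_adjoin hq0 hF huS) (Ucartan_le_adjoin hk')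

theorem UzeroOf_le_Uzero (hA : IsFiniteCartanDatum A d) (hq0 : q ≠ 0)
    (hq : ∀ n : ℕ, 0 < n → q ^ n ≠ 1) :
    UzeroOf A d q S ≤ Subalgebra.toSubmodule (Uzero A d q) := by
  rw [← UzeroOf_sup_idealOf hA hq0 hq S]; exact le_sup_left

theorem K_commute_of_mem_Uzero {x : U A d q} (hx : x ∈ Uzero A d q) (i : ι) :
    Commute (K A d q i) x := by
  have h := hx i
  rw [rootPairing_zero, zpow_zero, one_smul] at h
  have h1 : K A d q i * x * (Kinv A d q i * K A d q i) = x * K A d q i := by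
    rw [← mul_assoc, h]
  rwa [Kinv_mul_K, mul_one] at h1

theorem Kinv_commute_of_mem_Uzero {x : U A d q} (hx : x ∈ Uzero A d q) (i : ι) :
    Commute (Kinv A d q i) x :=
  (show Commute ((KUnit A d q i : (U A d q)ˣ) : U A d q) x from
    K_commute_of_mem_Uzero hx i).units_inv_left

theorem commute_of_mem_adjoin (hA : IsFiniteCartanDatum A d) (hq0 : q ≠ 0)
    (hq : ∀ n : ℕ, 0 < n → q ^ n ≠ 1) (hS : ∀ i ∈ S, ∀ j ∈ S, i ≠ j → A i j = 0) {x y : U A d q}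
    (hx : x ∈ Algebra.adjoin ℂ (leviGenerators A d q S))
    (hy : y ∈ Algebra.adjoin ℂ (leviGenerators A d q S)) : Commute x y := by
  have hE := E_commute_of_orthogonal hA hq0 hq hS
  have hF := F_commute_of_orthogonal hA hq0 hq hS
  have hU {z : U A d q} (hz : z ∈ leviGenerators A d q S) : z ∈ Uzero A d q := by
    have h : z ∈ Subalgebra.toSubmodule (Algebra.adjoin ℂ (leviGenerators A d q S)) :=
      Algebra.subset_adjoin hz
    rw [adjoin_leviGenerators hA hq0 hq hS] at h
    exact UzeroOf_le_Uzero hA hq0 hq h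
  have hgen : ∀ a ∈ leviGenerators A d q S, ∀ b ∈ leviGenerators A d q S, Commute a b := by
    rintro a ha b hb
    rcases ha with (⟨i, hi, rfl⟩ | ⟨i, rfl⟩) | ⟨i, rfl⟩
    · rcases hb with (⟨j, hj, rfl⟩ | ⟨j, rfl⟩) | ⟨j, rfl⟩
      · by_cases hij : i = j
        · subst hij; exact Commute.refl _
        · exact ((hE i hi j hj).mul_right (E_commute_F hij)).mul_left
            ((E_commute_F (Ne.symm hij)).symm.mul_right (hF i hi j hj))
      · exact (K_commute_of_mem_Uzero (hU (Or.inl (Or.inl ⟨i, hi, rfl⟩))) j).symm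
      · exact (Kinv_commute_of_mem_Uzero (hU (Or.inl (Or.inl ⟨i, hi, rfl⟩))) j).symm
    · exact K_commute_of_mem_Uzero (hU hb) i
    · exact Kinv_commute_of_mem_Uzero (hU hb) i
  exact Algebra.commute_of_mem_adjoin_of_forall_mem_commute hy fun b hb =>
    (Algebra.commute_of_mem_adjoin_of_forall_mem_commute hx fun a ha => hgen b hb a ha).symm

/-- A character of a subalgebra `B` with a complementary ideal `I` in `C` extends to `C`. -/
theorem exists_algHom_extension {R : Type*} [Ring R] [Algebra ℂ R] {B C : Subalgebra ℂ R}
    {I : Submodule ℂ R} (hsup : Subalgebra.toSubmodule B ⊔ I = Subalgebra.toSubmodule C)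
    (hdisj : Disjoint (Subalgebra.toSubmodule B) I)
    (hI : ∀ x ∈ C, ∀ y ∈ I, x * y ∈ I ∧ y * x ∈ I) (π : B →ₐ[ℂ] ℂ) :
    ∃ ψ : C →ₐ[ℂ] ℂ, ∀ (x : R) (hB : x ∈ B) (hC : x ∈ C), ψ ⟨x, hC⟩ = π ⟨x, hB⟩ := by
  have hBC : B ≤ C := fun x hx => by
    have h : x ∈ Subalgebra.toSubmodule C := hsup ▸ Submodule.mem_sup_left hx
    exact h
  have hex (x : C) : ∃ b : B, (x : R) - b ∈ I := by
    have h : (x : R) ∈ Subalgebra.toSubmodule C := x.2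
    rw [← hsup] at h
    obtain ⟨b, hb, y, hy, hxy⟩ := Submodule.mem_sup.mp h
    exact ⟨⟨b, hb⟩, by rw [← hxy]; simpa using hy⟩
  choose p hp using hex
  -- Directness makes the chosen projection unique; this is what turns `p` into an algebra map.
  have huniq (x : C) (b : B) (hb : (x : R) - b ∈ I) : p x = b := by
    have h1 : ((p x - b : B) : R) ∈ I := by simpa using sub_mem hb (hp x)
    have h2 := Submodule.disjoint_def.mp hdisj _ (p x - b).2 h1
    exact sub_eq_zero.mp (Subtype.ext h2)
  refine ⟨{ toFun := fun x => π (p x), map_one' := ?_, map_mul' := ?_, map_zero' := ?_,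
            map_add' := ?_, commutes' := ?_ }, ?_⟩
  · rw [huniq 1 1 (by simp), map_one]
  · intro x y
    rw [huniq (x * y) (p x * p y) ?_, map_mul]
    have h1 := (hI x x.2 _ (hp y)).1
    have h2 := (hI (p y) (hBC (p y).2) _ (hp x)).2
    have := add_mem h1 h2
    have e : (x : R) * (y - p y) + (x - p x) * p y = ((x * y : C) : R) - ((p x * p y : B) : R) := by
      push_cast; noncomm_ring
    rwa [e] at this
  · rw [huniq 0 0 (by simp), map_zero]
  · intro x y
    rw [huniq (x + y) (p x + p y) ?_, map_add]
    have := add_mem (hp x) (hp y)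
    rwa [sub_add_sub_comm] at this
  · intro r
    rw [huniq (algebraMap ℂ C r) (algebraMap ℂ B r) (by simp), AlgHom.commutes]
  · intro x hB hC
    change π (p ⟨x, hC⟩) = _
    rw [huniq ⟨x, hC⟩ ⟨x, hB⟩ (by simp)]

end QuantumEnveloping

end

theorem mainTheorem1 {ι : Type*} [Fintype ι] [DecidableEq ι]
    (A : Matrix ι ι ℤ) (d : ι → ℕ) (hA : IsFiniteCartanDatum A d)
    (q : ℂ) (hq0 : q ≠ 0) (hq : ∀ n : ℕ, 0 < n → q ^ n ≠ 1)
    (S : Set ι) (hS : ∀ i ∈ S, ∀ j ∈ S, i ≠ j → A i j = 0) :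
    -- the decomposition of `U_0` as the internal direct sum of `U_0^S` and `I^S`
    (QuantumEnveloping.UzeroOf A d q S ⊔ QuantumEnveloping.idealOf A d q S =
        Subalgebra.toSubmodule (QuantumEnveloping.Uzero A d q) ∧
      Disjoint (QuantumEnveloping.UzeroOf A d q S) (QuantumEnveloping.idealOf A d q S)) ∧
    -- `I^S` is a two-sided ideal of `U_0`
    (∀ x ∈ QuantumEnveloping.Uzero A d q, ∀ y ∈ QuantumEnveloping.idealOf A d q S,
      x * y ∈ QuantumEnveloping.idealOf A d q S ∧ y * x ∈ QuantumEnveloping.idealOf A d q S) ∧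
    -- `U_0^S` is (the underlying subspace of) a commutative subalgebra `B` of `U_0`
    ∃ B : Subalgebra ℂ (QuantumEnveloping.U A d q),
      Subalgebra.toSubmodule B = QuantumEnveloping.UzeroOf A d q S ∧
      B ≤ QuantumEnveloping.Uzero A d q ∧
      (∀ x ∈ B, ∀ y ∈ B, x * y = y * x) ∧
      B = Algebra.adjoin ℂ
        ({x | ∃ i ∈ S, x = QuantumEnveloping.E A d q i * QuantumEnveloping.F A d q i} ∪
          Set.range (QuantumEnveloping.K A d q) ∪ Set.range (QuantumEnveloping.Kinv A d q)) ∧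
      -- one-dimensional representations of `U_0^S` extend to `U_0`
      ∀ π : B →ₐ[ℂ] ℂ, ∃ ψ : QuantumEnveloping.Uzero A d q →ₐ[ℂ] ℂ,
        ∀ (x : QuantumEnveloping.U A d q) (hB : x ∈ B) (h0 : x ∈ QuantumEnveloping.Uzero A d q),
          ψ ⟨x, h0⟩ = π ⟨x, hB⟩ := by
  have hdisj := QuantumEnveloping.disjoint_UzeroOf_idealOf hA hq0 hq hS
  have hsup := QuantumEnveloping.UzeroOf_sup_idealOf hA hq0 hq S
  have hB := QuantumEnveloping.adjoin_leviGenerators hA hq0 hq hS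
  have hI : ∀ x ∈ QuantumEnveloping.Uzero A d q, ∀ y ∈ QuantumEnveloping.idealOf A d q S,
      x * y ∈ QuantumEnveloping.idealOf A d q S ∧ y * x ∈ QuantumEnveloping.idealOf A d q S :=
    fun _ hx _ hy => QuantumEnveloping.mul_mem_idealOf hA hq0 hq S hx hy
  refine ⟨⟨hsup, hdisj⟩, hI, Algebra.adjoin ℂ (QuantumEnveloping.leviGenerators A d q S), hB, ?_,
    fun x hx y hy => QuantumEnveloping.commute_of_mem_adjoin hA hq0 hq hS hx hy, rfl, ?_⟩
  · rw [← Subalgebra.toSubmodule.le_iff_le, hB]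
    exact QuantumEnveloping.UzeroOf_le_Uzero hA hq0 hq
  · rw [← hB] at hsup hdisj
    exact QuantumEnveloping.exists_algHom_extension hsup hdisj hI
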